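/- **Setting.** Let $K=\mathrm{GF}(q)$, let $A$ be an $n\times n$ matrix over $K$, accessible only through products of $A$ by a vector, each of which costs $\Omega\ge n$ operations. Let $p>n$ be a prime factor of $q-1$ and let $g$ be a generator of $K^\times$. Let $\mathcal F$ be the set of monic irreducible factors of the minimal polynomial of $A$. Let $P_1,\dots,P_k\in\mathcal F$ be distinct; they are the factors whose multiplicity in the characteristic polynomial $P^A_{\mathrm{char}}$ is unknown. Let $Q=\prod_{R\in\mathcal F\setminus\{P_1,\dots,P_k\}}R^{m_R}$, where $m_R$ is the multiplicity of $R$ in $P^A_{\mathrm{char}}$; $Q$ is given. Call $\lambda\in K$ *admissible* if $R(\lambda)\neq0$ for all $R\in\mathcal F$. **Algorithm (index calculus).** Input: $A,P_1,\dots,P_k,Q,g,p$. 1. Draw uniform points of $K$, rejecting those at which $Q$ or some $P_j$ vanishes. For the $l$-th accepted point $\lambda_l$ form the row $h_l=(\log_gP_j(\lambda_l)\bmod p)_{1\le j\le k}$, where $\log_g$ takes values in $\{0,\dots,q-2\}$. Continue until the rows have rank $k$ over $\mathbb Z/p$. If $n$ rows do not suffice, return "fail". 2. Let $B$ be the $k\times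 k$ matrix of the first $k$ independent rows. For these rows compute $b_i=\log_g\det(\lambda_iI-A)-\log_gQ(\lambda_i)\bmod p$. The determinants are computed by Wiedemann's black-box method with a random diagonal preconditioner and random vectors over a cubic extension field of $K$, repeated until it succeeds. 3. Solve $Bx=b$ over $\mathbb Z/p$ by Gaussian elimination, lift the solution to $x_j\in\{0,\dots,p-1\}$, and return $Q\prod_{j=1}^kP_j^{x_j}$. One operation in $K$ or $\mathbb Z/p$, one zero test, one random draw from $K$ and one look-up of a discrete logarithm in a precomputed table each have unit cost; an operation or draw in the cubic extension has a fixed constant cost, and a product of $A$ by a vector over this extension costs $3\Omega$. **Conjecture (discrete-log matrix), for the input $(A,P_1,\dots,P_k,g,p)$ and an error probability $\varepsilon$.** For independent uniformly random admissible $\lambda_1,\dots,\lambda_n$, the $n\times k$ matrix $(\log_gP_j(\lambda_i)\bmod p)_{i,j}$ over $\mathbb Z/p$ has rank $k$ with probability at least $1-\varepsilon$. **Theorem.** There is an absolute constant $C$ such that, for all inputs as above: * whenever the algorithm returns a polynomial, that polynomial is $P^A_{\mathrm{char}}$; * for every real $\varepsilon$ for which the conjecture holds for the input, the algorithm returns $P^A_{\mathrm{char}}$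 with probability at least $1-\varepsilon$; * if $q\ge 2n$, the expected number of operations of the algorithm is at most $C\,k\,n\,\Omega$. -/

import Mathlib

open Polynomial MeasureTheory
open scoped ENNReal

noncomputable section

namespace IndexCalculus

/-! ### Counting operations -/

/-- The result of a terminating computation together with the number of operations it used. -/
structure Timed (α : Type) where
  val : α
  cost : ℕ

instance : Monad Timed where
  pure a := ⟨a, 0⟩
  bind x f := ⟨(f x.val).val, x.cost + (f x.val).cost⟩

/-- A computation that may return nothing (`none`: it answers "fail" or it runs forever) and that
may use infinitely many operations. -/
structure Run (α : Type) where
  val : Option α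
  cost : ℕ∞

instance : Monad Run where
  pure a := ⟨some a, 0⟩
  bind x f :=
    match x.val with
    | none => ⟨none, x.cost⟩
    | some a => ⟨(f a).val, x.cost + (f a).cost⟩

instance : MonadLift Timed Run where
  monadLift x := ⟨some x.val, x.cost⟩

/-- Stop with the answer "fail". -/
def Run.fail {α : Type} : Run α := ⟨none, 0⟩

open Classical in
/-- `repeat … until`: perform the attempts number `0, 1, 2, …` until one of them succeeds, and pay
for all the attempts made. -/
def repeatUntil {α : Type} (f : ℕ → Timed (Option α)) : Run α where
  val := if h : ∃ t, (f t).val.isSome = true then (f (Nat.find h)).val else none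
  cost := if h : ∃ t, (f t).val.isSome = true
    then ((∑ s ∈ Finset.range (Nat.find h + 1), (f s).cost : ℕ) : ℕ∞) else ⊤

/-! Elementary operations. The number `w` is the price of one operation in the field at hand. -/

def addT {F : Type} [Field F] (w : ℕ) (a b : F) : Timed F := ⟨a + b, w⟩
def subT {F : Type} [Field F] (w : ℕ) (a b : F) : Timed F := ⟨a - b, w⟩
def mulT {F : Type} [Field F] (w : ℕ) (a b : F) : Timed F := ⟨a * b, w⟩
def divT {F : Type} [Field F] (w : ℕ) (a b : F) : Timed F := ⟨a / b, w⟩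

open Classical in
def isZeroT {F : Type} [Field F] (w : ℕ) (a : F) : Timed Bool := ⟨decide (a = 0), w⟩

/-- Draw one field element: the value is the entry `a` of the random tape. -/
def drawT {F : Type} (w : ℕ) (a : F) : Timed F := ⟨a, w⟩

/-- A `for` loop with independent bodies. -/
def forT {α : Type} {m : ℕ} (f : Fin m → Timed α) : Timed (Fin m → α) :=
  ⟨fun i => (f i).val, ∑ i, (f i).cost⟩

/-- Compute `m` terms and add them up, with one addition for each term. -/
def sumT {F : Type} [Field F] (w : ℕ) {m : ℕ} (f : Fin m → Timed F) : Timed F :=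
  ⟨∑ i, (f i).val, ∑ i, ((f i).cost + w)⟩

/-- Multiply `m` given elements, with one multiplication for each factor. -/
def prodT {F : Type} [Field F] (w : ℕ) {m : ℕ} (f : Fin m → F) : Timed F :=
  ⟨∏ i, f i, ∑ _i : Fin m, w⟩

/-! ### Polynomials -/

/-- The `i`-th step of Horner's rule for `P` at `x`. -/
def hornerT {K : Type} [Field K] (P : K[X]) (x : K) : ℕ → Timed K
  | 0 => pure (P.coeff P.natDegree)
  | i + 1 => do
    let t ← hornerT P x i
    let t ← mulT 1 t x
    addT 1 t (P.coeff (P.natDegree - (i + 1)))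

/-- Evaluation of a polynomial by Horner's rule. -/
def evalT {K : Type} [Field K] (P : K[X]) (x : K) : Timed K :=
  hornerT P x P.natDegree

/-- Schoolbook multiplication of polynomials, coefficient by coefficient. -/
def polyMulT {K : Type} [Field K] (P R : K[X]) : Timed K[X] := do
  let c ← forT (m := P.natDegree + R.natDegree + 1) fun i =>
    sumT 1 fun a : Fin (P.natDegree + 1) =>
      mulT 1 (P.coeff a) (if (a : ℕ) ≤ i then R.coeff (i - a) else 0)
  pure (∑ i, C (c i) * X ^ (i : ℕ))

/-- Multiply `R` by `P`, `m` times. -/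
def powMulT {K : Type} [Field K] (P : K[X]) : ℕ → K[X] → Timed K[X]
  | 0, R => pure R
  | m + 1, R => do
    let R ← polyMulT P R
    powMulT P m R

/-! ### Incremental Gaussian elimination -/

/-- A row of the triangular system: its pivot column (where `row` is `1`), its entries, and its
right-hand side. -/
structure Pivot (k : ℕ) (F : Type) where
  col : Fin k
  row : Fin k → F
  rhs : F

/-- Reduce the row `v` with right-hand side `β` by the rows of a triangular system. -/
def reduceT {k : ℕ} {F : Type} [Field F] :
    List (Pivot k F) → (Fin k → F) → F → Timed ((Fin k → F) × F)
  | [], v, β => pure (v, β)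
  | e :: E, v, β => do
    let v' ← forT fun c => do
      let t ← mulT 1 (v e.col) (e.row c)
      subT 1 (v c) t
    let t ← mulT 1 (v e.col) e.rhs
    let β' ← subT 1 β t
    reduceT E v' β'

/-- Add a row to the triangular system `E`; the answer is `none` if the row depends linearly on the
rows of `E`. -/
def insertT {k : ℕ} {F : Type} [Field F] (E : List (Pivot k F)) (v : Fin k → F) (β : F) :
    Timed (Option (List (Pivot k F))) := do
  let r ← reduceT E v β
  let z ← forT fun c => isZeroT 1 (r.1 c)
  match (List.finRange k).find? (fun c => !z c) with
  | none => pure none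
  | some c => do
    let row ← forT fun c' => divT 1 (r.1 c') (r.1 c)
    let rhs ← divT 1 r.2 (r.1 c)
    pure (some (E ++ [⟨c, row, rhs⟩]))

/-- Back substitution in a triangular system, from the last row to the first. -/
def backSubstT {k : ℕ} {F : Type} [Field F] : List (Pivot k F) → Timed (Fin k → F)
  | [] => pure 0
  | e :: E => do
    let x ← backSubstT E
    let t ← sumT 1 fun c => mulT 1 (e.row c) (x c)
    let t ← subT 1 e.rhs t
    pure (Function.update x e.col t)

/-! ### Black-box determinants

The determinant of `x • 1 - A` is computed by Wiedemann's method with a random diagonal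
preconditioner. The random elements are taken from an extension field `L` of degree `3`, so that
there are enough of them. -/

/-- An upper bound for the number of operations in a field that suffice for one operation in an
extension of degree `3`. In coordinates with respect to a basis with known structure constants,
addition takes `3`, multiplication `60` and division (Cramer's rule) fewer than `100` operations. -/
def extPrice : ℕ := 200

section Det

variable {n : ℕ} {K L : Type} [Field K] [Field L] [Algebra K L]

/-- The product of the black box `A` by a vector over `L`: one product over `K`, of price `Ω`, for
each coordinate of `L` over `K`. -/
def blackBoxT (A : Matrix (Fin n) (Fin n) K) (Ω : ℕ) (y : Fin n → L) : Timed (Fin n → L) :=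
  ⟨(A.map (algebraMap K L)).mulVec y, Module.finrank K L * Ω⟩

/-- The product of `diag(d) * (x • 1 - A)` by a vector. -/
def stepT (A : Matrix (Fin n) (Fin n) K) (Ω : ℕ) (x : K) (d y : Fin n → L) :
    Timed (Fin n → L) := do
  let z ← blackBoxT A Ω y
  forT fun i => do
    let t ← mulT extPrice (algebraMap K L x) (y i)
    let t ← subT extPrice t (z i)
    mulT extPrice (d i) t

/-- The first `m` terms of the sequence `u ⬝ᵥ y, u ⬝ᵥ M y, u ⬝ᵥ M² y, …` for
`M = diag(d) * (x • 1 - A)`. -/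
def momentsT (A : Matrix (Fin n) (Fin n) K) (Ω : ℕ) (x : K) (d u : Fin n → L) :
    ℕ → (Fin n → L) → Timed (List L)
  | 0, _ => pure []
  | m + 1, y => do
    let s ← sumT extPrice fun i => mulT extPrice (u i) (y i)
    let y' ← stepT A Ω x d y
    let r ← momentsT A Ω x d u m y'
    pure (s :: r)

/-- Two consecutive monic orthogonal polynomials (given by their coefficients) of a sequence of
moments, and two quotients that the three-term recurrence needs. -/
structure OrthState (n : ℕ) (L : Type) where
  cur : Fin (n + 1) → L
  prev : Fin (n + 1) → L
  h : L
  g : L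

/-- The `j`-th monic orthogonal polynomial for the moments `s`, by the three-term recurrence; the
answer is `none` if one of the divisors vanishes. -/
def orthT (n : ℕ) (s : ℕ → L) : ℕ → Timed (Option (OrthState n L))
  | 0 => pure (some ⟨Pi.single 0 1, 0, 1, 0⟩)
  | j + 1 => do
    match ← orthT n s j with
    | none => pure none
    | some σ => do
      let h ← sumT extPrice fun c => mulT extPrice (σ.cur c) (s ((c : ℕ) + j))
      match ← isZeroT extPrice h with
      | true => pure none
      | false => do
        let e ← sumT extPrice fun c => mulT extPrice (σ.cur c) (s ((c : ℕ) + j + 1))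
        let g ← divT extPrice e h
        let a ← subT extPrice g σ.g
        let b ← divT extPrice h σ.h
        let next ← forT fun c : Fin (n + 1) => do
          let t₁ ← mulT extPrice a (σ.cur c)
          let t₂ ← mulT extPrice b (σ.prev c)
          let t ← subT extPrice (Fin.cases 0 (fun i => σ.cur i.castSucc) c) t₁
          subT extPrice t t₂
        pure (some ⟨next, σ.cur, h, g⟩)

/-- One attempt to compute `det (x • 1 - A)`, with the random vectors `r 0, r 1, r 2` over `L`. The
`n`-th orthogonal polynomial of the moments is the characteristic polynomial of
`diag(r 0) * (x • 1 - A)`; its constant coefficient gives the determinant. -/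
def detTryT (A : Matrix (Fin n) (Fin n) K) (Ω : ℕ) (x : K) (r : Fin 3 → Fin n → L) :
    Timed (Option K) := do
  let d ← forT fun i => drawT extPrice (r 0 i)
  let u ← forT fun i => drawT extPrice (r 1 i)
  let v ← forT fun i => drawT extPrice (r 2 i)
  let e ← prodT extPrice d
  match ← isZeroT extPrice e with
  | true => pure none
  | false => do
    let s ← momentsT A Ω x d u (2 * n) v
    match ← orthT n (fun i => s.getD i 0) n with
    | none => pure none
    | some σ => do
      let t ← prodT extPrice (fun _ : Fin n => (-1 : L))
      let t ← mulT extPrice t (σ.cur 0)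
      let t ← divT extPrice t e
      pure (some (Function.invFun (algebraMap K L) t))

end Det

/-! ### The algorithm -/

/-- The discrete logarithm of `x` in base `g`: the least exponent `i` with `g ^ i = x`. -/
def dlog {K : Type} [Field K] (g : Kˣ) (x : K) : ℕ := sInf {i : ℕ | (g : K) ^ i = x}

/-- Look up a discrete logarithm in a table and reduce it modulo `p`, at unit price. -/
def dlogT {K : Type} [Field K] (g : Kˣ) (p : ℕ) (x : K) : Timed (ZMod p) := ⟨(dlog g x : ZMod p), 1⟩

/-- The random choices: `(l, t)` indexes the point drawn in the `t`-th attempt for the `l`-th row,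
and `(i, t, a, c)` the `c`-th entry of the `a`-th random vector used in the `t`-th attempt for the
`i`-th determinant. -/
abbrev Tape (n : ℕ) (K L : Type) : Type :=
  (ℕ × ℕ → K) × (ℕ × ℕ × Fin 3 × Fin n → L)

/-- All the random choices are independent and uniform. -/
def tapeMeasure (n : ℕ) (K L : Type) [Field K] [Fintype K] [MeasurableSpace K]
    [Field L] [Fintype L] [MeasurableSpace L] : Measure (Tape n K L) :=
  (Measure.infinitePi fun _ : ℕ × ℕ => (PMF.uniformOfFintype K).toMeasure).prod
    (Measure.infinitePi fun _ : ℕ × ℕ × Fin 3 × Fin n => (PMF.uniformOfFintype L).toMeasure)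

/-- An evaluation point `x`, the values `α j` of the factors with unknown multiplicity, and the
value `γ` of the known partial product. -/
structure Point (k : ℕ) (K : Type) where
  x : K
  α : Fin k → K
  γ : K

/-- A row of the linear system, without its right-hand side. -/
structure LogRow (k p : ℕ) (K : Type) where
  x : K
  γ : K
  logs : Fin k → ZMod p

section Algorithm

variable {n k : ℕ} (p : ℕ) [Fact p.Prime] {K L : Type} [Field K] [Field L] [Algebra K L]

/-- Evaluate all the polynomials at the random point `a`; the attempt fails if a value is zero. -/
def pointTryT (P : Fin k → K[X]) (Q : K[X]) (a : K) : Timed (Option (Point k K)) := do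
  let x ← drawT 1 a
  let α ← forT fun j => evalT (P j) x
  let γ ← evalT Q x
  let zα ← forT fun j => isZeroT 1 (α j)
  let zγ ← isZeroT 1 γ
  pure (if (∀ j, zα j = false) ∧ zγ = false then some ⟨x, α, γ⟩ else none)

/-- The main loop: at most `m` more rows are built, `l` rows have been built already, `E` is the
triangular form of the independent rows found so far and `B` is the list of these rows. -/
def rowLoop (g : Kˣ) (P : Fin k → K[X]) (Q : K[X]) (tape : ℕ × ℕ → K) :
    (m l : ℕ) → List (Pivot k (ZMod p)) → List (LogRow k p K) → Run (List (LogRow k p K))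
  | 0, _, E, B => if E.length = k then pure B else Run.fail
  | m + 1, l, E, B =>
    if E.length = k then pure B else do
      let pt ← repeatUntil fun t => pointTryT P Q (tape (l, t))
      let h ← (forT fun j => dlogT g p (pt.α j) : Timed (Fin k → ZMod p))
      match ← (insertT E h 0 : Timed (Option (List (Pivot k (ZMod p))))) with
      | none => rowLoop g P Q tape m (l + 1) E B
      | some E' => rowLoop g P Q tape m (l + 1) E' (B ++ [⟨pt.x, pt.γ, h⟩])

/-- Compute the right-hand sides of the rows `B`, the first of which has number `i`, and bring the
system into triangular form. -/
def rhsLoop (A : Matrix (Fin n) (Fin n) K) (Ω : ℕ) (g : Kˣ)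
    (tape : ℕ × ℕ × Fin 3 × Fin n → L) :
    List (LogRow k p K) → (i : ℕ) → List (Pivot k (ZMod p)) → Run (List (Pivot k (ZMod p)))
  | [], _, E => pure E
  | r :: B, i, E => do
    let δ ← repeatUntil fun t => detTryT A Ω r.x fun a c => tape (i, t, a, c)
    let b₁ ← (dlogT g p δ : Timed (ZMod p))
    let b₂ ← (dlogT g p r.γ : Timed (ZMod p))
    let b ← (subT 1 b₁ b₂ : Timed (ZMod p))
    match ← (insertT E r.logs b : Timed (Option (List (Pivot k (ZMod p))))) with
    | none => Run.fail
    | some E' => rhsLoop A Ω g tape B (i + 1) E'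

/-- The index-calculus algorithm for the characteristic polynomial of the black box `A`, where a
product of `A` by a vector costs `Ω` operations. `P` lists the irreducible factors of the minimal
polynomial that have an unknown multiplicity in the characteristic polynomial, and `Q` is the part
of the characteristic polynomial made of the other factors. -/
def indexCalculus (A : Matrix (Fin n) (Fin n) K) (Ω : ℕ) (g : Kˣ) (P : Fin k → K[X]) (Q : K[X])
    (ω : Tape n K L) : Run K[X] := do
  let B ← rowLoop p g P Q ω.1 n 0 [] []
  let E ← rhsLoop p A Ω g ω.2 B 0 []
  let x ← (backSubstT E : Timed (Fin k → ZMod p))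
  ((List.finRange k).foldlM (fun R j => powMulT (P j) (x j).val R) Q : Timed K[X])

end Algorithm

/-! ### The input and the conjectured property -/

section Input

variable {n k : ℕ} {K : Type} [Field K]

open Classical in
/-- The set of the monic irreducible factors of the minimal polynomial of `A`. -/
def minpolyFactors (A : Matrix (Fin n) (Fin n) K) : Finset K[X] :=
  (UniqueFactorizationMonoid.normalizedFactors (minpoly K A)).toFinset

open Classical in
/-- The product of the irreducible factors of the minimal polynomial that are not among the `P j`,
each raised to its multiplicity in the characteristic polynomial. -/
def knownPart (A : Matrix (Fin n) (Fin n) K) (P : Fin k → K[X]) : K[X] :=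
  ∏ R ∈ minpolyFactors A \ Finset.univ.image P, R ^ multiplicity R A.charpoly

/-- The points at which the logarithms of all the irreducible factors are defined. -/
def Admissible (A : Matrix (Fin n) (Fin n) K) : Type :=
  {x : K // ∀ R ∈ minpolyFactors A, R.eval x ≠ 0}

/-- The matrix of the discrete logarithms, modulo `p`, of the values of the `P j` at `n` points. -/
def dlogMatrix (A : Matrix (Fin n) (Fin n) K) (g : Kˣ) (p : ℕ) (P : Fin k → K[X])
    (x : Fin n → Admissible A) : Matrix (Fin n) (Fin k) (ZMod p) :=
  Matrix.of fun i j => (dlog g ((P j).eval (x i).1) : ZMod p)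

/-- The probability that the matrix of the discrete logarithms at `n` independent uniform
admissible points has rank `k`. -/
def fullRankProb (A : Matrix (Fin n) (Fin n) K) (g : Kˣ) (p : ℕ) (P : Fin k → K[X]) : ℝ :=
  Nat.card {x : Fin n → Admissible A // (dlogMatrix A g p P x).rank = k} /
    Nat.card (Fin n → Admissible A)

/-- The conjectured property of the input, with "high probability" meaning at least `1 - ε`. -/
def DlogConjecture (A : Matrix (Fin n) (Fin n) K) (g : Kˣ) (p : ℕ) (P : Fin k → K[X])
    (ε : ℝ) : Prop :=
  1 - ε ≤ fullRankProb A g p P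

end Input

end IndexCalculus

end

/-!
If `λ` is not a root of the characteristic polynomial, then the factorization
`det (λ - A) = Q(λ) * ∏ j, P j (λ) ^ m j` becomes, after taking logarithms to the base `g` modulo
`p ∣ q - 1`, a linear equation over `ZMod p` for the multiplicities `m j`
(`sum_dlog_mul_multiplicity`). Once `k` independent equations are known, the solution is unique, and
since `m j ≤ n < p`, the multiplicities themselves can be read off from it (`val_backSubstT`). So
every answer is right as soon as every determinant is, and three facts remain.

*The determinants.* An attempt computes the moments `u ⬝ᵥ Mⁱ v` of `M = diag(d) * (λ - A)` and their
orthogonal polynomials by a three-term recurrence. If the recurrence reaches degree `n`, the pairing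
it defines is nondegenerate in degrees less than `n` (`eq_zero_of_pairing_eq_zero`), hence the last
orthogonal polynomial is the only monic one of degree `n` that is orthogonal to all lower degrees.
By the Cayley-Hamilton theorem the characteristic polynomial of `M` is another such polynomial, so
the constant coefficient gives `det M` (`detTryT_eq_some`).
The recurrence breaks down only where one of the `n` leading Hankel determinants vanishes
(`exists_det_hankel_eq_zero`). These determinants are nonzero polynomials in `d, u, v`: over the
algebraic closure, the diagonal entries can be adjusted one at a time until all eigenspaces of `M`
are lines (`exists_hasLineEigenspaces`); a vector `u` that is not orthogonal to any eigenvector then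
makes the rows `u Mⁱ` independent (`exists_observable`), and `v` can be chosen so that the Hankel
matrix becomes triangular with ones on the antidiagonal. As the total degree is at most
`(n + 2) ^ 3 / 3`, while the cubic extension has `q ^ 3 ≥ (n + 2) ^ 3` elements, the lemma of
Schwartz and Zippel bounds the probability of a failure by one third (`card_detTryT_eq_none_le`).

*The probability of success.* The first accepted points of the `n` rows are independent and uniform
among the admissible points (`measure_first_mem`), and with probability one no determinant fails
forever (`ae_detTryT_ne_none`). If the matrix of the logarithms at these `n` points has rank `k`,
the elimination, which keeps a row exactly when it is independent of those before, finds `k` rows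
(`rowLoop_isSome_or`). The conjecture is a lower bound for the probability of this event.

*The cost.* On every tape, the cost is bounded by a sum over the rows of a constant times the number
of attempts (`rowLoop_cost_le`, `rhsLoop_cost_le`). The expected number of attempts
(`lintegral_attempts`) is at most two: for a point, since at most `n ≤ q / 2` points are roots of
the characteristic polynomial, and for a determinant by the bound above. The two kinds of random
choices are independent, and the bound for the determinants is uniform in the choice of the points,
so that integrating over the two tapes in turn yields the expected cost (`lintegral_cost_le`).
-/

namespace IndexCalculus

/-! ### Values and costs of the elementary computations -/

namespace Timed

variable {α β : Type}

@[simp] lemma val_pure (a : α) : (pure a : Timed α).val = a := rfl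
@[simp] lemma cost_pure (a : α) : (pure a : Timed α).cost = 0 := rfl
@[simp] lemma val_bind (x : Timed α) (f : α → Timed β) : (x >>= f).val = (f x.val).val := rfl
@[simp] lemma cost_bind (x : Timed α) (f : α → Timed β) :
    (x >>= f).cost = x.cost + (f x.val).cost := rfl

end Timed

@[simp] lemma drawT_val {F : Type} (w : ℕ) (a : F) : (drawT w a).val = a := rfl
@[simp] lemma drawT_cost {F : Type} (w : ℕ) (a : F) : (drawT w a).cost = w := rfl

section Elementary

variable {F : Type} [Field F] (w : ℕ) (a b : F)

@[simp] lemma addT_val : (addT w a b).val = a + b := rfl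
@[simp] lemma addT_cost : (addT w a b).cost = w := rfl
@[simp] lemma subT_val : (subT w a b).val = a - b := rfl
@[simp] lemma subT_cost : (subT w a b).cost = w := rfl
@[simp] lemma mulT_val : (mulT w a b).val = a * b := rfl
@[simp] lemma mulT_cost : (mulT w a b).cost = w := rfl
@[simp] lemma divT_val : (divT w a b).val = a / b := rfl
@[simp] lemma divT_cost : (divT w a b).cost = w := rfl
open Classical in
@[simp] lemma isZeroT_val : (isZeroT w a).val = decide (a = 0) := by
  simp [isZeroT]
@[simp] lemma isZeroT_cost : (isZeroT w a).cost = w := rfl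

variable {α : Type} {m : ℕ}

@[simp] lemma forT_val (f : Fin m → Timed α) : (forT f).val = fun i => (f i).val := rfl
@[simp] lemma forT_cost (f : Fin m → Timed α) : (forT f).cost = ∑ i, (f i).cost := rfl
@[simp] lemma sumT_val (f : Fin m → Timed F) : (sumT w f).val = ∑ i, (f i).val := rfl
@[simp] lemma sumT_cost (f : Fin m → Timed F) : (sumT w f).cost = ∑ i, ((f i).cost + w) := rfl
@[simp] lemma prodT_val (f : Fin m → F) : (prodT w f).val = ∏ i, f i := rfl
@[simp] lemma prodT_cost (f : Fin m → F) : (prodT w f).cost = m * w := by simp [prodT]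

end Elementary

/-! ### Values and costs of the polynomial computations -/

section Poly

variable {K : Type} [Field K]

lemma hornerT_val (P : K[X]) (x : K) (i : ℕ) :
    (hornerT P x i).val =
      ∑ j ∈ Finset.range (i + 1), P.coeff (P.natDegree - j) * x ^ (i - j) := by
  induction i with
  | zero => simp [hornerT]
  | succ i ih =>
    rw [Finset.sum_range_succ]
    simp only [hornerT, Timed.val_bind, addT_val, mulT_val, ih, Nat.sub_self, pow_zero, mul_one,
      Finset.sum_mul]
    congr 1
    refine Finset.sum_congr rfl fun j hj => ?_
    rw [Nat.succ_sub (by simpa [Nat.lt_succ_iff] using hj), pow_succ, mul_assoc]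

@[simp] lemma hornerT_cost (P : K[X]) (x : K) (i : ℕ) : (hornerT P x i).cost = 2 * i := by
  induction i with
  | zero => rfl
  | succ i ih => simp only [hornerT, Timed.cost_bind, ih, mulT_cost, addT_cost]; ring

@[simp] lemma evalT_val (P : K[X]) (x : K) : (evalT P x).val = P.eval x := by
  rw [evalT, hornerT_val, eval_eq_sum_range, ← Finset.sum_range_reflect]
  refine Finset.sum_congr rfl fun j hj => ?_
  have : j ≤ P.natDegree := by simpa [Nat.lt_succ_iff] using hj
  congr 2 <;> omega

@[simp] lemma evalT_cost (P : K[X]) (x : K) : (evalT P x).cost = 2 * P.natDegree := by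
  simp [evalT]

@[simp] lemma polyMulT_val (P R : K[X]) : (polyMulT P R).val = P * R := by
  have hc : ∀ i : ℕ, (∑ a : Fin (P.natDegree + 1),
      P.coeff a * (if (a : ℕ) ≤ i then R.coeff (i - a) else 0)) = (P * R).coeff i := by
    intro i
    rw [coeff_mul, Finset.Nat.sum_antidiagonal_eq_sum_range_succ
      (fun a b => P.coeff a * R.coeff b),
      Fin.sum_univ_eq_sum_range
        (fun a => P.coeff a * (if a ≤ i then R.coeff (i - a) else 0)) (P.natDegree + 1)]
    trans ∑ a ∈ Finset.range (P.natDegree + 1 + i),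
        P.coeff a * (if a ≤ i then R.coeff (i - a) else 0)
    · refine Finset.sum_subset (by intro a; simp; omega) fun a _ ha => ?_
      rw [coeff_eq_zero_of_natDegree_lt (by simpa using ha), zero_mul]
    · symm
      refine Finset.sum_subset_zero_on_sdiff (by intro a; simp; omega) (fun a ha => ?_) ?_
      · rw [if_neg (by simp at ha; omega), mul_zero]
      · intro a ha
        rw [if_pos (by simp at ha; omega)]
  simp only [polyMulT, Timed.val_bind, forT_val, sumT_val, mulT_val, Timed.val_pure, hc]
  rw [Fin.sum_univ_eq_sum_range (fun i => C ((P * R).coeff i) * X ^ i)]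
  exact (as_sum_range_C_mul_X_pow' (P * R)
    (Nat.lt_succ_of_le natDegree_mul_le)).symm

@[simp] lemma polyMulT_cost (P R : K[X]) :
    (polyMulT P R).cost = (P.natDegree + R.natDegree + 1) * ((P.natDegree + 1) * 2) := by
  simp [polyMulT]

@[simp] lemma powMulT_val (P : K[X]) (m : ℕ) (R : K[X]) : (powMulT P m R).val = P ^ m * R := by
  induction m generalizing R with
  | zero => simp [powMulT]
  | succ m ih => simp only [powMulT, Timed.val_bind, polyMulT_val, ih]; ring

lemma powMulT_cost_le (P : K[X]) {N : ℕ} (m : ℕ) (R : K[X])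
    (h : m * P.natDegree + R.natDegree ≤ N) :
    (powMulT P m R).cost ≤ m * ((N + 1) * ((P.natDegree + 1) * 2)) := by
  induction m generalizing R with
  | zero => simp [powMulT]
  | succ m ih =>
    simp only [powMulT, Timed.cost_bind, polyMulT_val, polyMulT_cost]
    have h1 := ih (P * R) (by
      have := natDegree_mul_le (p := P) (q := R)
      rw [add_mul, one_mul] at h; omega)
    have h2 : P.natDegree + R.natDegree + 1 ≤ N + 1 := by
      rw [add_mul, one_mul] at h
      have := Nat.zero_le (m * P.natDegree)
      omega
    calc _ ≤ (N + 1) * ((P.natDegree + 1) * 2) + m * ((N + 1) * ((P.natDegree + 1) * 2)) :=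
          add_le_add (Nat.mul_le_mul_right _ h2) h1
      _ = _ := by ring

lemma foldlM_powMulT_val {k : ℕ} (P : Fin k → K[X]) (x : Fin k → ℕ) (l : List (Fin k)) (R : K[X]) :
    (l.foldlM (fun R j => powMulT (P j) (x j) R) R : Timed K[X]).val =
      R * (l.map fun j => P j ^ x j).prod := by
  induction l generalizing R with
  | nil => simp
  | cons j l ih =>
    simp only [List.foldlM_cons, Timed.val_bind, powMulT_val, ih, List.map_cons, List.prod_cons]
    ring

lemma foldlM_powMulT_cost_le {k : ℕ} (P : Fin k → K[X]) (x : Fin k → ℕ) {N : ℕ}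
    (l : List (Fin k)) (R : K[X])
    (h : (l.map fun j => x j * (P j).natDegree).sum + R.natDegree ≤ N) :
    (l.foldlM (fun R j => powMulT (P j) (x j) R) R : Timed K[X]).cost ≤
      (l.map fun j => x j * ((N + 1) * (((P j).natDegree + 1) * 2))).sum := by
  induction l generalizing R with
  | nil => simp
  | cons j l ih =>
    simp only [List.foldlM_cons, Timed.cost_bind, powMulT_val, List.map_cons, List.sum_cons] at h ⊢
    refine add_le_add (powMulT_cost_le _ _ _ (by omega)) (ih _ ?_)
    have h1 := natDegree_mul_le (p := P j ^ x j) (q := R)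
    have h2 := natDegree_pow_le (p := P j) (n := x j)
    omega

end Poly

/-! ### Incremental Gaussian elimination -/

section Gauss

variable {k : ℕ} {F : Type} [Field F]

/-- The part of a pivot row that does not depend on the right-hand sides. -/
def Pivot.shape (e : Pivot k F) : Fin k × (Fin k → F) := (e.col, e.row)

/-- A list of pivot rows in triangular form: every row has a `1` in its pivot column, and the rows
that come later have a `0` there. -/
structure IsTriangular (E : List (Pivot k F)) : Prop where
  row_col : ∀ e ∈ E, e.row e.col = 1
  pairwise : E.Pairwise fun e e' => e'.row e.col = 0

/-- `z` solves all the equations of the list. -/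
def Solves (z : Fin k → F) (E : List (Pivot k F)) : Prop := ∀ e ∈ E, e.row ⬝ᵥ z = e.rhs

lemma isTriangular_nil : IsTriangular ([] : List (Pivot k F)) := ⟨by simp, by simp⟩

lemma IsTriangular.tail {e : Pivot k F} {E : List (Pivot k F)} (h : IsTriangular (e :: E)) :
    IsTriangular E :=
  ⟨fun e' he' => h.row_col e' (List.mem_cons_of_mem _ he'), (List.pairwise_cons.1 h.pairwise).2⟩

lemma reduceT_cons_val (e : Pivot k F) (E : List (Pivot k F)) (v : Fin k → F) (β : F) :
    (reduceT (e :: E) v β).val =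
      (reduceT E (v - v e.col • e.row) (β - v e.col * e.rhs)).val := rfl

@[simp] lemma reduceT_cost (E : List (Pivot k F)) (v : Fin k → F) (β : F) :
    (reduceT E v β).cost = E.length * (k * 2 + 2) := by
  induction E generalizing v β with
  | nil => simp [reduceT]
  | cons e E ih => simp [reduceT, ih]; ring

lemma reduceT_dotProduct {z : Fin k → F} {E : List (Pivot k F)} (hz : Solves z E)
    (v : Fin k → F) (β : F) :
    (reduceT E v β).val.1 ⬝ᵥ z - (reduceT E v β).val.2 = v ⬝ᵥ z - β := by
  induction E generalizing v β with
  | nil => rfl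
  | cons e E ih =>
    rw [reduceT_cons_val, ih fun e' he' => hz e' (List.mem_cons_of_mem _ he'), sub_dotProduct,
      smul_dotProduct, hz e List.mem_cons_self, smul_eq_mul]
    ring

lemma sub_reduceT_mem_span (E : List (Pivot k F)) (v : Fin k → F) (β : F) :
    v - (reduceT E v β).val.1 ∈ Submodule.span F (Pivot.row '' {e | e ∈ E}) := by
  induction E generalizing v β with
  | nil => simp [reduceT]
  | cons e E ih =>
    rw [reduceT_cons_val]
    have h1 := Submodule.span_mono (R := F) (s := Pivot.row '' {e | e ∈ E})
      (t := Pivot.row '' {e' | e' ∈ e :: E})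
      (Set.image_mono fun e' he' => List.mem_cons_of_mem _ he')
      (ih (v - v e.col • e.row) (β - v e.col * e.rhs))
    have h2 : v e.col • e.row ∈ Submodule.span F (Pivot.row '' {e' | e' ∈ e :: E}) :=
      Submodule.smul_mem _ _ (Submodule.subset_span ⟨e, List.mem_cons_self, rfl⟩)
    convert! Submodule.add_mem _ h1 h2 using 1
    abel

lemma reduceT_apply_eq_zero {E : List (Pivot k F)} {c : Fin k} (hE : ∀ e ∈ E, e.row c = 0)
    (v : Fin k → F) (β : F) (hv : v c = 0) : (reduceT E v β).val.1 c = 0 := by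
  induction E generalizing v β with
  | nil => exact hv
  | cons e E ih =>
    rw [reduceT_cons_val]
    refine ih (fun e' he' => hE e' (List.mem_cons_of_mem _ he')) _ _ ?_
    simp [hv, hE e List.mem_cons_self]

lemma reduceT_apply_col {E : List (Pivot k F)} (hE : IsTriangular E) (v : Fin k → F) (β : F)
    {e : Pivot k F} (he : e ∈ E) : (reduceT E v β).val.1 e.col = 0 := by
  induction E generalizing v β with
  | nil => simp at he
  | cons e' E ih =>
    rw [reduceT_cons_val]
    rcases List.mem_cons.1 he with rfl | he
    · refine reduceT_apply_eq_zero
        (fun e' he' => (List.pairwise_cons.1 hE.pairwise).1 e' he') _ _ ?_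
      simp [hE.row_col e List.mem_cons_self]
    · exact ih hE.tail _ _ he

lemma reduceT_congr_shape {E E' : List (Pivot k F)} (h : E.map Pivot.shape = E'.map Pivot.shape)
    (v : Fin k → F) (β β' : F) : (reduceT E v β).val.1 = (reduceT E' v β').val.1 := by
  induction E generalizing v β β' E' with
  | nil => cases E' with
    | nil => rfl
    | cons => simp at h
  | cons e E ih => cases E' with
    | nil => simp at h
    | cons e' E' =>
      simp only [List.map_cons, List.cons.injEq, Pivot.shape, Prod.mk.injEq] at h
      rw [reduceT_cons_val, reduceT_cons_val, h.1.1, h.1.2]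
      exact ih h.2 _ _ _

open Classical in
/-- The first column in which a row has a nonzero entry. -/
noncomputable def leadingCol (v : Fin k → F) : Option (Fin k) :=
  (List.finRange k).find? fun c => !decide (v c = 0)

lemma leadingCol_eq_none {v : Fin k → F} (h : leadingCol v = none) : v = 0 := by
  ext c
  simpa using List.find?_eq_none.1 h c (List.mem_finRange c)

lemma leadingCol_eq_some {v : Fin k → F} {c : Fin k} (h : leadingCol v = some c) : v c ≠ 0 := by
  simpa using List.find?_some h

lemma insertT_val (E : List (Pivot k F)) (v : Fin k → F) (β : F) :
    (insertT E v β).val = (leadingCol (reduceT E v β).val.1).map fun c =>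
      E ++ [⟨c, fun c' => (reduceT E v β).val.1 c' / (reduceT E v β).val.1 c,
        (reduceT E v β).val.2 / (reduceT E v β).val.1 c⟩] := by
  simp only [insertT, Timed.val_bind, forT_val, isZeroT_val, leadingCol]
  cases (List.finRange k).find? _ <;> rfl

lemma insertT_cost_le (E : List (Pivot k F)) (v : Fin k → F) (β : F) :
    (insertT E v β).cost ≤ E.length * (k * 2 + 2) + (2 * k + 1) := by
  simp only [insertT, Timed.cost_bind, reduceT_cost, forT_cost, isZeroT_cost, forT_val,
    isZeroT_val]
  cases (List.finRange k).find? _ <;> simp <;> omega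

lemma insertT_eq_some {E E' : List (Pivot k F)} {v : Fin k → F} {β : F}
    (h : (insertT E v β).val = some E') :
    ∃ c, (reduceT E v β).val.1 c ≠ 0 ∧
      E' = E ++ [⟨c, fun c' => (reduceT E v β).val.1 c' / (reduceT E v β).val.1 c,
        (reduceT E v β).val.2 / (reduceT E v β).val.1 c⟩] := by
  rw [insertT_val, Option.map_eq_some_iff] at h
  obtain ⟨c, hc, rfl⟩ := h
  exact ⟨c, leadingCol_eq_some hc, rfl⟩

lemma insertT_length {E E' : List (Pivot k F)} {v : Fin k → F} {β : F}
    (h : (insertT E v β).val = some E') : E'.length = E.length + 1 := by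
  obtain ⟨c, -, rfl⟩ := insertT_eq_some h
  simp

lemma insertT_isTriangular {E E' : List (Pivot k F)} {v : Fin k → F} {β : F}
    (hE : IsTriangular E) (h : (insertT E v β).val = some E') : IsTriangular E' := by
  obtain ⟨c, hc, rfl⟩ := insertT_eq_some h
  refine ⟨fun e he => ?_, List.pairwise_append.2 ⟨hE.pairwise, by simp, fun e he e' he' => ?_⟩⟩
  · rcases List.mem_append.1 he with he | he
    · exact hE.row_col e he
    · rw [List.mem_singleton.1 he]
      exact div_self hc
  · rw [List.mem_singleton.1 he']
    simp [reduceT_apply_col hE v β he]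

lemma insertT_solves {E E' : List (Pivot k F)} {v : Fin k → F} {β : F} {z : Fin k → F}
    (hz : Solves z E) (hv : v ⬝ᵥ z = β) (h : (insertT E v β).val = some E') : Solves z E' := by
  obtain ⟨c, hc, rfl⟩ := insertT_eq_some h
  intro e he
  rcases List.mem_append.1 he with he | he
  · exact hz e he
  · rw [List.mem_singleton.1 he]
    have := reduceT_dotProduct hz v β
    rw [hv, sub_self, sub_eq_zero] at this
    simp only [dotProduct] at this ⊢
    rw [← this, Finset.sum_div]
    exact Finset.sum_congr rfl fun i _ => by ring

/-- A row is accepted or rejected according to the left-hand sides alone. -/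
lemma insertT_congr_shape {E E' E₁ : List (Pivot k F)}
    (hs : E.map Pivot.shape = E'.map Pivot.shape) {v : Fin k → F} {β : F} (β' : F)
    (h : (insertT E v β).val = some E₁) :
    ∃ E₁', (insertT E' v β').val = some E₁' ∧ E₁.map Pivot.shape = E₁'.map Pivot.shape := by
  rw [insertT_val, reduceT_congr_shape hs v β β', Option.map_eq_some_iff] at h
  obtain ⟨c, hc, rfl⟩ := h
  rw [insertT_val, hc]
  exact ⟨_, rfl, by simp [hs, Pivot.shape]⟩

lemma span_row_mono {E E' : List (Pivot k F)} {v : Fin k → F} {β : F}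
    (h : (insertT E v β).val = some E') :
    Submodule.span F (Pivot.row '' {e | e ∈ E}) ≤ Submodule.span F (Pivot.row '' {e | e ∈ E'}) := by
  obtain ⟨c, -, rfl⟩ := insertT_eq_some h
  exact Submodule.span_mono (Set.image_mono fun e he => List.mem_append_left _ he)

lemma mem_span_row_of_insertT_eq_some {E E' : List (Pivot k F)} {v : Fin k → F} {β : F}
    (h : (insertT E v β).val = some E') :
    v ∈ Submodule.span F (Pivot.row '' {e | e ∈ E'}) := by
  have h1 := span_row_mono h (sub_reduceT_mem_span E v β)
  obtain ⟨c, hc, hE'⟩ := insertT_eq_some h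
  have h2 : (reduceT E v β).val.1 ∈ Submodule.span F (Pivot.row '' {e | e ∈ E'}) := by
    have : (reduceT E v β).val.1 = (reduceT E v β).val.1 c •
        fun c' => (reduceT E v β).val.1 c' / (reduceT E v β).val.1 c := by
      ext i
      simp [mul_div_cancel₀ _ hc]
    rw [this]
    exact Submodule.smul_mem _ _ (Submodule.subset_span
      ⟨⟨c, fun c' => (reduceT E v β).val.1 c' / (reduceT E v β).val.1 c,
        (reduceT E v β).val.2 / (reduceT E v β).val.1 c⟩, by simp [hE'], rfl⟩)
  simpa using Submodule.add_mem _ h1 h2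

lemma mem_span_row_of_insertT_eq_none {E : List (Pivot k F)} {v : Fin k → F} {β : F}
    (h : (insertT E v β).val = none) :
    v ∈ Submodule.span F (Pivot.row '' {e | e ∈ E}) := by
  rw [insertT_val, Option.map_eq_none_iff] at h
  simpa [leadingCol_eq_none h] using sub_reduceT_mem_span E v β

@[simp] lemma backSubstT_cost (E : List (Pivot k F)) :
    (backSubstT E).cost = E.length * (2 * k + 1) := by
  induction E with
  | nil => simp [backSubstT]
  | cons e E ih => simp [backSubstT, ih]; ring

/-- Back substitution in the last rows of a triangular system recovers the pivot coordinates of a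
solution, provided that these rows involve no other coordinates. -/
lemma backSubstT_val {z : Fin k → F} {E : List (Pivot k F)} (hE : IsTriangular E)
    (hz : Solves z E) (hcol : ∀ c, (∀ e ∈ E, e.col ≠ c) → ∀ e ∈ E, e.row c = 0) (c : Fin k) :
    ((∃ e ∈ E, e.col = c) → (backSubstT E).val c = z c) ∧
      ((∀ e ∈ E, e.col ≠ c) → (backSubstT E).val c = 0) := by
  induction E generalizing c with
  | nil => exact ⟨by simp, fun _ => rfl⟩
  | cons e E ih =>
    have hp := List.pairwise_cons.1 hE.pairwise
    have hne : ∀ e' ∈ E, e'.col ≠ e.col := fun e' he' heq => by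
      have h1 := hp.1 e' he'
      rw [← heq, hE.row_col e' (List.mem_cons_of_mem _ he')] at h1
      exact one_ne_zero h1
    have ih := ih hE.tail (fun e' he' => hz e' (List.mem_cons_of_mem _ he')) (by
      intro c hc e' he'
      by_cases h : e.col = c
      · rw [← h]; exact hp.1 e' he'
      · refine hcol c (fun e'' he'' => ?_) e' (List.mem_cons_of_mem _ he')
        rcases List.mem_cons.1 he'' with rfl | he''
        exacts [h, hc e'' he''])
    have hval : (backSubstT (e :: E)).val =
        Function.update (backSubstT E).val e.col (e.rhs - e.row ⬝ᵥ (backSubstT E).val) := rfl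
    rw [hval]
    by_cases hc : c = e.col
    · subst hc
      refine ⟨fun _ => ?_, fun h => absurd rfl (h e List.mem_cons_self)⟩
      rw [Function.update_self, ← hz e List.mem_cons_self, ← dotProduct_sub, dotProduct,
        Finset.sum_eq_single e.col]
      · rw [hE.row_col e List.mem_cons_self, Pi.sub_apply, (ih e.col).2 hne]; ring
      · intro c' _ hc'
        by_cases h : ∃ e' ∈ E, e'.col = c'
        · rw [Pi.sub_apply, (ih c').1 h, sub_self, mul_zero]
        · push Not at h
          rw [hcol c' (fun e' he' => ?_) e List.mem_cons_self, zero_mul]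
          rcases List.mem_cons.1 he' with rfl | he'
          exacts [hc'.symm, h e' he']
      · simp
    · rw [Function.update_of_ne hc]
      refine ⟨?_, fun h => (ih c).2 fun e' he' => h e' (List.mem_cons_of_mem _ he')⟩
      rintro ⟨e', he', rfl⟩
      rcases List.mem_cons.1 he' with rfl | he'
      · exact absurd rfl hc
      · exact (ih _).1 ⟨e', he', rfl⟩

lemma backSubstT_val_of_length_eq {z : Fin k → F} {E : List (Pivot k F)} (hE : IsTriangular E)
    (hz : Solves z E) (hk : E.length = k) : (backSubstT E).val = z := by
  classical
  have hnd : (E.map Pivot.col).Nodup := by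
    rw [List.nodup_iff_pairwise_ne, List.pairwise_map]
    refine hE.pairwise.imp_of_mem fun {e e'} _ he' h heq => ?_
    rw [heq, hE.row_col e' he'] at h
    exact one_ne_zero h
  have huniv : (E.map Pivot.col).toFinset = Finset.univ := by
    rw [← Finset.card_eq_iff_eq_univ, List.toFinset_card_of_nodup hnd]
    simpa using hk
  have hex : ∀ c, ∃ e ∈ E, e.col = c := fun c => by
    simpa [huniv] using (List.mem_toFinset (a := c) (l := E.map Pivot.col)).symm
  ext c
  refine (backSubstT_val hE hz (fun c h => ?_) c).1 (hex c)
  obtain ⟨e, he, hc⟩ := hex c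
  exact absurd hc (h e he)

end Gauss

/-! ### Discrete logarithms -/

section Dlog

variable {K : Type} [Field K] [Fintype K] {g : Kˣ} {p : ℕ}

lemma pow_dlog (hg : ∀ y : Kˣ, y ∈ Subgroup.zpowers g) {x : K} (hx : x ≠ 0) :
    (g : K) ^ dlog g x = x := by
  have hmem : Units.mk0 x hx ∈ Submonoid.powers g := mem_powers_iff_mem_zpowers.2 (hg _)
  obtain ⟨i, hi⟩ := hmem
  have : {i : ℕ | (g : K) ^ i = x}.Nonempty := ⟨i, by simpa using congrArg Units.val hi⟩
  exact Nat.sInf_mem this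

/-- Exponents of equal powers of a generator agree modulo every divisor of `q - 1`. -/
lemma natCast_eq_of_pow_eq (hg : ∀ y : Kˣ, y ∈ Subgroup.zpowers g)
    (hp : p ∣ Fintype.card K - 1) {a b : ℕ} (h : (g : K) ^ a = (g : K) ^ b) :
    (a : ZMod p) = b := by
  classical
  rw [ZMod.natCast_eq_natCast_iff]
  have h1 : g ^ a = g ^ b := by ext; simpa using h
  have h2 : orderOf g = Fintype.card K - 1 := by
    rw [orderOf_eq_card_of_forall_mem_zpowers hg, Nat.card_eq_fintype_card, Fintype.card_units]
  exact (pow_eq_pow_iff_modEq.1 h1).of_dvd (h2 ▸ hp)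

lemma dlog_mul (hg : ∀ y : Kˣ, y ∈ Subgroup.zpowers g) (hp : p ∣ Fintype.card K - 1) {x y : K}
    (hx : x ≠ 0) (hy : y ≠ 0) : (dlog g (x * y) : ZMod p) = dlog g x + dlog g y := by
  rw [← Nat.cast_add]
  refine natCast_eq_of_pow_eq hg hp ?_
  rw [pow_add, pow_dlog hg hx, pow_dlog hg hy, pow_dlog hg (mul_ne_zero hx hy)]

lemma dlog_one (hg : ∀ y : Kˣ, y ∈ Subgroup.zpowers g) (hp : p ∣ Fintype.card K - 1) :
    (dlog g (1 : K) : ZMod p) = 0 := by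
  simpa using dlog_mul hg hp (one_ne_zero (α := K)) one_ne_zero

lemma dlog_pow (hg : ∀ y : Kˣ, y ∈ Subgroup.zpowers g) (hp : p ∣ Fintype.card K - 1) {x : K}
    (hx : x ≠ 0) (m : ℕ) : (dlog g (x ^ m) : ZMod p) = m * dlog g x := by
  induction m with
  | zero => simp [dlog_one hg hp]
  | succ m ih => rw [pow_succ, dlog_mul hg hp (pow_ne_zero _ hx) hx, ih]; push_cast; ring

lemma dlog_prod (hg : ∀ y : Kˣ, y ∈ Subgroup.zpowers g) (hp : p ∣ Fintype.card K - 1)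
    {ι : Type*} (s : Finset ι) {x : ι → K} (hx : ∀ i ∈ s, x i ≠ 0) :
    (dlog g (∏ i ∈ s, x i) : ZMod p) = ∑ i ∈ s, (dlog g (x i) : ZMod p) := by
  classical
  induction s using Finset.induction_on with
  | empty => simp [dlog_one hg hp]
  | insert i s hi ih =>
    rw [Finset.prod_insert hi, Finset.sum_insert hi, dlog_mul hg hp (hx i (by simp))
      (Finset.prod_ne_zero_iff.2 fun j hj => hx j (Finset.mem_insert_of_mem hj)),
      ih fun j hj => hx j (Finset.mem_insert_of_mem hj)]

end Dlog

/-! ### The factorization of the characteristic polynomial -/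

section Factorization

variable {n k : ℕ} {K : Type} [Field K] (A : Matrix (Fin n) (Fin n) K)

/-- A root of the characteristic polynomial in an extension field is a root of the minimal
polynomial. -/
lemma aeval_minpoly_eq_zero {E : Type} [Field E] [Algebra K E] {α : E}
    (h : aeval α A.charpoly = 0) : aeval α (minpoly K A) = 0 := by
  set A' := A.map (algebraMap K E) with hA'
  have h1 : α ∈ spectrum E A' := by
    rw [Matrix.mem_spectrum_iff_isRoot_charpoly, hA', Matrix.charpoly_map, IsRoot,
      eval_map_algebraMap,
      h]
  have h2 : aeval A' ((minpoly K A).map (algebraMap K E)) = 0 := by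
    rw [aeval_map_algebraMap]
    have := aeval_algHom_apply (Algebra.ofId K E).mapMatrix A (minpoly K A)
    rw [minpoly.aeval, map_zero] at this
    exact this
  have h3 := spectrum.subset_polynomial_aeval A' ((minpoly K A).map (algebraMap K E))
    (Set.mem_image_of_mem _ h1)
  rw [h2] at h3
  rcases subsingleton_or_nontrivial (Matrix (Fin n) (Fin n) E) with hs | hs
  · rw [spectrum.of_subsingleton] at h3
    exact absurd h3 (Set.notMem_empty _)
  · rw [spectrum.zero_eq, Set.mem_singleton_iff, eval_map_algebraMap] at h3
    exact h3

lemma irreducible_dvd_minpoly {R : K[X]} (hR : Irreducible R) (hm : R.Monic)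
    (h : R ∣ A.charpoly) : R ∣ minpoly K A := by
  obtain ⟨α, hα⟩ := IsAlgClosed.exists_aeval_eq_zero (AlgebraicClosure K) R
    (degree_pos_of_irreducible hR).ne'
  rw [minpoly.eq_of_irreducible_of_monic hR hα hm]
  exact minpoly.dvd _ _ (aeval_minpoly_eq_zero A (aeval_eq_zero_of_dvd_aeval_eq_zero h hα))

open Classical in
lemma minpolyFactors_eq :
    minpolyFactors A = (UniqueFactorizationMonoid.normalizedFactors A.charpoly).toFinset := by
  have h0 : minpoly K A ≠ 0 := minpoly.ne_zero (Matrix.isIntegral A)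
  have h1 : A.charpoly ≠ 0 := (Matrix.charpoly_monic A).ne_zero
  ext R
  rw [minpolyFactors, Multiset.mem_toFinset, Multiset.mem_toFinset,
    UniqueFactorizationMonoid.mem_normalizedFactors_iff' h0,
    UniqueFactorizationMonoid.mem_normalizedFactors_iff' h1]
  refine and_congr_right fun hR => and_congr_right fun hn => ⟨fun h => ?_, fun h => ?_⟩
  · exact h.trans (Matrix.minpoly_dvd_charpoly A)
  · refine irreducible_dvd_minpoly A hR ?_ h
    rw [← hn]
    exact monic_normalize hR.ne_zero

variable {A}

lemma monic_of_mem_minpolyFactors {R : K[X]} (h : R ∈ minpolyFactors A) : R.Monic := by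
  classical
  rw [minpolyFactors, Multiset.mem_toFinset] at h
  rw [← UniqueFactorizationMonoid.normalize_normalized_factor R h]
  exact monic_normalize (UniqueFactorizationMonoid.irreducible_of_normalized_factor R h).ne_zero

lemma natDegree_pos_of_mem_minpolyFactors {R : K[X]} (h : R ∈ minpolyFactors A) :
    0 < R.natDegree := by
  classical
  rw [minpolyFactors, Multiset.mem_toFinset] at h
  exact (UniqueFactorizationMonoid.irreducible_of_normalized_factor R h).natDegree_pos

open Classical in
lemma multiplicity_eq_count {R : K[X]} (h : R ∈ minpolyFactors A) :
    multiplicity R A.charpoly =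
      (UniqueFactorizationMonoid.normalizedFactors A.charpoly).count R := by
  rw [minpolyFactors_eq, Multiset.mem_toFinset] at h
  have h1 := UniqueFactorizationMonoid.emultiplicity_eq_count_normalizedFactors
    (UniqueFactorizationMonoid.irreducible_of_normalized_factor R h)
    (Matrix.charpoly_monic A).ne_zero
  rw [UniqueFactorizationMonoid.normalize_normalized_factor R h] at h1
  exact multiplicity_eq_of_emultiplicity_eq_some h1

lemma multiplicity_pos {R : K[X]} (h : R ∈ minpolyFactors A) :
    0 < multiplicity R A.charpoly := by
  classical
  rw [multiplicity_eq_count h, Multiset.count_pos]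
  rwa [minpolyFactors_eq, Multiset.mem_toFinset] at h

variable (A) in
lemma charpoly_eq_prod_minpolyFactors :
    A.charpoly = ∏ R ∈ minpolyFactors A, R ^ multiplicity R A.charpoly := by
  classical
  have h0 := (Matrix.charpoly_monic A).ne_zero
  calc A.charpoly = (UniqueFactorizationMonoid.normalizedFactors A.charpoly).prod := by
        rw [UniqueFactorizationMonoid.prod_normalizedFactors_eq h0,
          (Matrix.charpoly_monic A).normalize_eq_self]
    _ = ∏ R ∈ minpolyFactors A, R ^
          (UniqueFactorizationMonoid.normalizedFactors A.charpoly).count R := by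
        rw [Finset.prod_multiset_count, minpolyFactors_eq]
    _ = _ := Finset.prod_congr rfl fun R hR => by rw [multiplicity_eq_count hR]

variable {P : Fin k → K[X]}

lemma charpoly_eq_knownPart_mul (hP : Function.Injective P) (hmem : ∀ j, P j ∈ minpolyFactors A) :
    A.charpoly = knownPart A P * ∏ j, P j ^ multiplicity (P j) A.charpoly := by
  classical
  have h1 : Finset.univ.image P ⊆ minpolyFactors A := by
    intro R hR
    obtain ⟨j, -, rfl⟩ := Finset.mem_image.1 hR
    exact hmem j
  conv_lhs => rw [charpoly_eq_prod_minpolyFactors A, ← Finset.prod_sdiff h1,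
    Finset.prod_image (fun i _ j _ h => hP h)]
  rw [knownPart]

lemma knownPart_monic : (knownPart A P).Monic := by
  classical
  exact monic_prod_of_monic _ _ fun R hR =>
    (monic_of_mem_minpolyFactors (Finset.mem_sdiff.1 hR).1).pow _

lemma sum_natDegree_add (hP : Function.Injective P) (hmem : ∀ j, P j ∈ minpolyFactors A) :
    ∑ j, multiplicity (P j) A.charpoly * (P j).natDegree + (knownPart A P).natDegree = n := by
  have h1 := congrArg natDegree (charpoly_eq_knownPart_mul hP hmem)
  have h2 : ∀ j ∈ Finset.univ, (P j ^ multiplicity (P j) A.charpoly).Monic :=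
    fun j _ => (monic_of_mem_minpolyFactors (hmem j)).pow _
  rw [Matrix.charpoly_natDegree_eq_dim, Fintype.card_fin,
    knownPart_monic.natDegree_mul (monic_prod_of_monic _ _ h2),
    natDegree_prod_of_monic _ _ h2] at h1
  simp only [natDegree_pow] at h1
  omega

lemma multiplicity_le (hP : Function.Injective P) (hmem : ∀ j, P j ∈ minpolyFactors A)
    (j : Fin k) : multiplicity (P j) A.charpoly ≤ n := by
  have h1 := sum_natDegree_add hP hmem
  have h2 := Finset.single_le_sum (f := fun j => multiplicity (P j) A.charpoly * (P j).natDegree)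
    (fun j _ => Nat.zero_le _) (Finset.mem_univ j)
  have h3 := Nat.le_mul_of_pos_right (multiplicity (P j) A.charpoly)
    (natDegree_pos_of_mem_minpolyFactors (hmem j))
  omega

lemma sum_natDegree_le (hP : Function.Injective P) (hmem : ∀ j, P j ∈ minpolyFactors A) :
    ∑ j, (P j).natDegree + (knownPart A P).natDegree ≤ n := by
  conv_rhs => rw [← sum_natDegree_add hP hmem]
  gcongr with j
  exact Nat.le_mul_of_pos_left _ (multiplicity_pos (hmem j))

lemma card_factors_le (hP : Function.Injective P) (hmem : ∀ j, P j ∈ minpolyFactors A) :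
    k ≤ n := by
  have h1 := sum_natDegree_le hP hmem
  have h2 : ∑ _j : Fin k, 1 ≤ ∑ j, (P j).natDegree :=
    Finset.sum_le_sum fun j _ => natDegree_pos_of_mem_minpolyFactors (hmem j)
  simp at h2
  omega

lemma forall_eval_ne_zero_iff (a : K) :
    (∀ R ∈ minpolyFactors A, R.eval a ≠ 0) ↔ A.charpoly.eval a ≠ 0 := by
  conv_rhs => rw [charpoly_eq_prod_minpolyFactors A, eval_prod, Finset.prod_ne_zero_iff]
  refine forall₂_congr fun R hR => ?_
  rw [eval_pow, pow_ne_zero_iff (multiplicity_pos hR).ne']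

lemma eval_factors_ne_zero_iff (hP : Function.Injective P) (hmem : ∀ j, P j ∈ minpolyFactors A)
    (a : K) : ((∀ j, (P j).eval a ≠ 0) ∧ (knownPart A P).eval a ≠ 0) ↔ A.charpoly.eval a ≠ 0 := by
  conv_rhs => rw [charpoly_eq_knownPart_mul hP hmem, eval_mul, mul_ne_zero_iff, eval_prod,
    Finset.prod_ne_zero_iff]
  rw [and_comm]
  simp only [Finset.mem_univ, true_implies, eval_pow]
  refine and_congr_right fun _ => forall_congr' fun j => ?_
  rw [pow_ne_zero_iff (multiplicity_pos (hmem j)).ne']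

variable (A) in
open Classical in
lemma card_roots_charpoly_le [Fintype K] :
    (Finset.univ.filter fun a : K => A.charpoly.eval a = 0).card ≤ n := by
  calc _ ≤ A.charpoly.roots.toFinset.card := Finset.card_le_card fun a ha => by
        rw [Multiset.mem_toFinset, mem_roots (Matrix.charpoly_monic A).ne_zero]
        exact (Finset.mem_filter.1 ha).2
    _ ≤ A.charpoly.roots.card := Multiset.toFinset_card_le _
    _ ≤ n := by simpa [Matrix.charpoly_natDegree_eq_dim] using card_roots' A.charpoly

/-- The multiplicities solve every equation of the linear system. -/
lemma sum_dlog_mul_multiplicity [Fintype K] {g : Kˣ} {p : ℕ}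
    (hg : ∀ y : Kˣ, y ∈ Subgroup.zpowers g) (hp : p ∣ Fintype.card K - 1)
    (hP : Function.Injective P) (hmem : ∀ j, P j ∈ minpolyFactors A) {a : K}
    (ha : A.charpoly.eval a ≠ 0) :
    (fun j => (dlog g ((P j).eval a) : ZMod p)) ⬝ᵥ
        (fun j => (multiplicity (P j) A.charpoly : ZMod p)) =
      dlog g (A.charpoly.eval a) - dlog g ((knownPart A P).eval a) := by
  obtain ⟨h1, h2⟩ := (eval_factors_ne_zero_iff hP hmem a).2 ha
  have h3 : A.charpoly.eval a =
      (knownPart A P).eval a * ∏ j, (P j).eval a ^ multiplicity (P j) A.charpoly := by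
    conv_lhs => rw [charpoly_eq_knownPart_mul hP hmem]
    simp [eval_mul, eval_prod]
  rw [h3, dlog_mul hg hp h2 (Finset.prod_ne_zero_iff.2 fun j _ => pow_ne_zero _ (h1 j)),
    add_sub_cancel_left, dlog_prod hg hp _ fun j _ => pow_ne_zero _ (h1 j), dotProduct]
  exact Finset.sum_congr rfl fun j _ => by rw [dlog_pow hg hp (h1 j), mul_comm]

end Factorization

/-! ### Orthogonal polynomials of a sequence of moments -/

section Orthogonal

variable {n : ℕ} {L : Type} [Field L] {s : ℕ → L}

/-- The pairing of the polynomial with coefficients `c` with the monomial of degree `i`, for the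
functional that takes the monomial of degree `j` to `s j`. -/
def pairing (s : ℕ → L) (c : Fin (n + 1) → L) (i : ℕ) : L := ∑ a, c a * s ((a : ℕ) + i)

/-- The Hankel matrix of size `m` of the moments `s`. -/
def hankel {R : Type} (s : ℕ → R) (m : ℕ) : Matrix (Fin m) (Fin m) R :=
  Matrix.of fun a b => s ((a : ℕ) + b)

open Classical in
lemma orthT_succ_val (s : ℕ → L) (j : ℕ) :
    (orthT n s (j + 1)).val = (orthT n s j).val.bind fun σ =>
      if pairing s σ.cur j = 0 then none else
        some ⟨fun c => (Fin.cases 0 (fun i => σ.cur i.castSucc) c : L) -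
            (pairing s σ.cur (j + 1) / pairing s σ.cur j - σ.g) * σ.cur c -
              pairing s σ.cur j / σ.h * σ.prev c,
          σ.cur, pairing s σ.cur j, pairing s σ.cur (j + 1) / pairing s σ.cur j⟩ := by
  simp only [orthT, Timed.val_bind]
  cases (orthT n s j).val with
  | none => rfl
  | some σ =>
    simp only [Timed.val_bind, sumT_val, mulT_val, isZeroT_val, Option.bind_some]
    by_cases h : pairing s σ.cur j = 0
    · have h' := h
      rw [pairing] at h'
      simp only [h, h', decide_true, if_true, Timed.val_pure]
    · have h' := h
      rw [pairing] at h'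
      simp only [h, h', decide_false, if_false]
      rfl

lemma orthT_cost_le (s : ℕ → L) (j : ℕ) :
    (orthT n s j).cost ≤ j * ((n + 1) * (8 * extPrice) + 4 * extPrice) := by
  induction j with
  | zero => simp [orthT]
  | succ j ih =>
    simp only [orthT, Timed.cost_bind]
    rw [add_mul, one_mul]
    refine add_le_add ih ?_
    cases (orthT n s j).val with
    | none => simp
    | some σ =>
      simp only [Timed.cost_bind, sumT_cost, mulT_cost, isZeroT_cost]
      split <;> simp <;> ring_nf <;> omega

/-- The invariant of the three-term recurrence after `j` steps: `cur` is monic of degree `j` and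
orthogonal to all monomials of lower degree, `prev` is the preceding orthogonal polynomial (zero for
`j = 0`), and `h`, `g * h` are its pairings with the monomials of degrees `j - 1` and `j`. -/
structure IsOrthogonal (s : ℕ → L) (j : ℕ) (σ : OrthState n L) : Prop where
  cur_eq_zero : ∀ c : Fin (n + 1), j < c → σ.cur c = 0
  cur_eq_one : ∀ c : Fin (n + 1), (c : ℕ) = j → σ.cur c = 1
  cur_orth : ∀ i < j, pairing s σ.cur i = 0
  prev_eq_zero : ∀ c : Fin (n + 1), j ≤ c → σ.prev c = 0
  prev_orth : ∀ i, i + 1 < j → pairing s σ.prev i = 0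
  h_ne_zero : σ.h ≠ 0
  prev_h : ∀ i, i + 1 = j → pairing s σ.prev i = σ.h
  prev_g : pairing s σ.prev j = σ.g * σ.h

lemma pairing_sub (s : ℕ → L) (c d : Fin (n + 1) → L) (i : ℕ) :
    pairing s (fun a => c a - d a) i = pairing s c i - pairing s d i := by
  simp [pairing, sub_mul, Finset.sum_sub_distrib]

lemma pairing_smul (s : ℕ → L) (t : L) (c : Fin (n + 1) → L) (i : ℕ) :
    pairing s (fun a => t * c a) i = t * pairing s c i := by
  simp [pairing, mul_assoc, Finset.mul_sum]

/-- Multiplication by the variable is adjoint to itself, as long as the degree stays at most `n`. -/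
lemma pairing_shift (s : ℕ → L) {c : Fin (n + 1) → L} (hc : c (Fin.last n) = 0) (i : ℕ) :
    pairing s (fun a => (Fin.cases 0 (fun b => c b.castSucc) a : L)) i = pairing s c (i + 1) := by
  rw [pairing, pairing, Fin.sum_univ_succ, Fin.sum_univ_castSucc]
  simp only [Fin.cases_zero, Fin.cases_succ, zero_mul, zero_add, hc, add_zero]
  refine Finset.sum_congr rfl fun a _ => ?_
  congr 2
  simp
  ring

lemma orthT_isOrthogonal {j : ℕ} (hj : j ≤ n) {σ : OrthState n L}
    (h : (orthT n s j).val = some σ) : IsOrthogonal s j σ := by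
  classical
  induction j generalizing σ with
  | zero =>
    obtain rfl : _ = σ := Option.some.inj h
    refine ⟨fun c hc => ?_, fun c hc => ?_, by simp, by simp, by simp, one_ne_zero, by simp, ?_⟩
    · exact Pi.single_eq_of_ne (M := fun _ : Fin (n + 1) => L) (by rintro rfl; simp at hc) _
    · have : c = 0 := Fin.ext (by simpa using hc)
      rw [this]; exact Pi.single_eq_same (M := fun _ : Fin (n + 1) => L) 0 1
    · simp [pairing]
  | succ j ih =>
    rw [orthT_succ_val, Option.bind_eq_some_iff] at h
    obtain ⟨τ, hτ, h⟩ := h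
    have ih := ih (by omega) hτ
    split_ifs at h with h0
    obtain rfl := Option.some.inj h
    set hh := pairing s τ.cur j with hhh
    have hlast : τ.cur (Fin.last n) = 0 := ih.cur_eq_zero _ (by simpa using hj)
    refine ⟨fun c hc => ?_, fun c hc => ?_, fun i hi => ?_, fun c hc => ih.cur_eq_zero c (by omega),
      fun i hi => ih.cur_orth i (by omega), h0, fun i hi => ?_, ?_⟩
    · dsimp only
      rw [ih.cur_eq_zero c (by omega), ih.prev_eq_zero c (by omega)]
      induction c using Fin.cases with
      | zero => simp
      | succ c =>
        simp only [Fin.cases_succ]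
        rw [ih.cur_eq_zero c.castSucc (by simp at hc ⊢; omega)]
        ring
    · dsimp only
      rw [ih.cur_eq_zero c (by omega), ih.prev_eq_zero c (by omega)]
      induction c using Fin.cases with
      | zero => simp at hc
      | succ c =>
        simp only [Fin.cases_succ]
        rw [ih.cur_eq_one c.castSucc (by simp at hc ⊢; omega)]
        ring
    · rw [pairing_sub, pairing_sub, pairing_smul, pairing_smul, pairing_shift s hlast]
      rcases Nat.lt_succ_iff_lt_or_eq.1 hi with hi | rfl
      · rw [ih.cur_orth i hi]
        by_cases h1 : i + 1 = j
        · have := ih.h_ne_zero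
          rw [ih.prev_h i h1, h1, ← hhh]
          field_simp
          ring
        · rw [ih.cur_orth (i + 1) (by omega), ih.prev_orth i (by omega)]
          ring
      · have := ih.h_ne_zero
        rw [ih.prev_g, ← hhh]
        field_simp
        ring
    · obtain rfl : i = j := by omega
      rfl
    · exact (div_mul_cancel₀ _ h0).symm

lemma orthT_eq_some_of_le {j : ℕ} {σ : OrthState n L} (h : (orthT n s j).val = some σ)
    {i : ℕ} (hi : i < j) :
    ∃ τ : OrthState n L, (orthT n s i).val = some τ ∧ pairing s τ.cur i ≠ 0 := by
  classical
  induction j generalizing σ with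
  | zero => omega
  | succ j ih =>
    rw [orthT_succ_val, Option.bind_eq_some_iff] at h
    obtain ⟨τ, hτ, h⟩ := h
    rcases Nat.lt_succ_iff_lt_or_eq.1 hi with hi | rfl
    · exact ih hτ hi
    · refine ⟨τ, hτ, fun h0 => ?_⟩
      simp [h0] at h

/-- If the orthogonal polynomials exist up to degree `n`, then a polynomial of degree less than `n`
that is orthogonal to all polynomials of degree less than `n` vanishes. -/
lemma eq_zero_of_pairing_eq_zero {σ : OrthState n L} (h : (orthT n s n).val = some σ)
    {w : Fin (n + 1) → L} (hw : w (Fin.last n) = 0) (ho : ∀ i < n, pairing s w i = 0) : w = 0 := by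
  -- The leading coefficient is the pairing with an orthogonal polynomial of the same degree.
  have key : ∀ m, m ≤ n → ∀ c : Fin (n + 1), n - m ≤ c → w c = 0 := by
    intro m
    induction m with
    | zero =>
      intro _ c hc
      have : c = Fin.last n := Fin.ext (by have := c.2; simp; omega)
      rw [this, hw]
    | succ m ih =>
      intro hm c hc
      have ih := ih (by omega)
      by_cases hc' : n - m ≤ c
      · exact ih c hc'
      have hcm : (c : ℕ) < n := by omega
      obtain ⟨τ, hτ, hne⟩ := orthT_eq_some_of_le h hcm
      have hO := orthT_isOrthogonal hcm.le hτ
      have h1 : ∑ i : Fin (n + 1), τ.cur i * pairing s w i = 0 := by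
        refine Finset.sum_eq_zero fun i _ => ?_
        by_cases hi : (i : ℕ) < n
        · rw [ho i hi, mul_zero]
        · rw [hO.cur_eq_zero i (by omega), zero_mul]
      have h2 : ∑ i : Fin (n + 1), τ.cur i * pairing s w i =
          ∑ a : Fin (n + 1), w a * pairing s τ.cur a := by
        simp only [pairing, Finset.mul_sum]
        rw [Finset.sum_comm]
        refine Finset.sum_congr rfl fun a _ => Finset.sum_congr rfl fun i _ => ?_
        rw [add_comm (i : ℕ)]
        ring
      rw [h2, Finset.sum_eq_single c] at h1
      · exact (mul_eq_zero.1 h1).resolve_right hne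
      · intro a _ hac
        rcases lt_or_gt_of_ne (Fin.val_ne_of_ne hac) with hlt | hgt
        · rw [hO.cur_orth a hlt, mul_zero]
        · rw [ih a (by omega), zero_mul]
      · simp
  ext c
  exact key n le_rfl c (by omega)

/-- The recurrence breaks down only at a vanishing Hankel determinant: there the coefficients of an
orthogonal polynomial are in the kernel of the Hankel matrix. -/
lemma exists_det_hankel_eq_zero {j : ℕ} (hj : j ≤ n)
    (h : (orthT n s j : Timed (Option (OrthState n L))).val = none) :
    ∃ i < j, (hankel s (i + 1)).det = 0 := by
  classical
  induction j with
  | zero => simp [orthT] at h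
  | succ j ih =>
    rw [orthT_succ_val] at h
    cases hτ : (orthT n s j : Timed (Option (OrthState n L))).val with
    | none =>
      obtain ⟨i, hi, h⟩ := ih (by omega) hτ
      exact ⟨i, by omega, h⟩
    | some τ =>
      have hO := orthT_isOrthogonal (by omega) hτ
      rw [hτ] at h
      have h0 : pairing s τ.cur j = 0 := by
        by_contra h0
        simp [h0] at h
      refine ⟨j, by omega, Matrix.exists_mulVec_eq_zero_iff.1
        ⟨fun b => τ.cur (b.castLE (by omega)), fun hz => ?_, ?_⟩⟩
      · have := congrFun hz (Fin.last j)
        rw [hO.cur_eq_one _ (by simp)] at this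
        exact one_ne_zero this
      · ext a
        have h1 : pairing s τ.cur a = 0 := by
          rcases Nat.lt_succ_iff_lt_or_eq.1 a.2 with ha | ha
          · exact hO.cur_orth a ha
          · rw [ha, h0]
        rw [Pi.zero_apply, ← h1, pairing, Matrix.mulVec, dotProduct]
        refine Fintype.sum_of_injective (Fin.castLE (by omega)) (Fin.castLE_injective _) _ _
          (fun c hc => ?_) fun b => ?_
        · rw [hO.cur_eq_zero c ?_, zero_mul]
          by_contra hlt
          exact hc ⟨⟨c, by omega⟩, rfl⟩
        · simp only [hankel, Matrix.of_apply, Fin.val_castLE]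
          rw [add_comm (b : ℕ), mul_comm]

end Orthogonal

/-! ### One attempt at a determinant -/

section DetTry

variable {n : ℕ} {K L : Type} [Field K] [Field L] [Algebra K L]

/-- The preconditioned matrix `diag(d) * (x • 1 - A)` over the extension field. -/
def precond (A : Matrix (Fin n) (Fin n) K) (x : K) (d : Fin n → L) : Matrix (Fin n) (Fin n) L :=
  Matrix.diagonal d * (Matrix.scalar (Fin n) x - A).map (algebraMap K L)

/-- The moments `u ⬝ᵥ Mⁱ v`. -/
def moment {R : Type} [CommRing R] (M : Matrix (Fin n) (Fin n) R) (u v : Fin n → R) (i : ℕ) : R :=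
  u ⬝ᵥ (M ^ i).mulVec v

variable (A : Matrix (Fin n) (Fin n) K) (Ω : ℕ) (x : K)

lemma stepT_val (d y : Fin n → L) : (stepT A Ω x d y).val = (precond A x d).mulVec y := by
  ext i
  have h : (Matrix.scalar (Fin n) x - A).map (algebraMap K L) =
      Matrix.scalar (Fin n) (algebraMap K L x) - A.map (algebraMap K L) := by
    ext a b
    by_cases hab : a = b <;> simp [hab]
  rw [precond, h, ← Matrix.mulVec_mulVec, Matrix.mulVec_diagonal, Matrix.sub_mulVec, Pi.sub_apply]
  simp [stepT, blackBoxT, Matrix.scalar_apply, Matrix.mulVec_diagonal]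

lemma stepT_cost (h3 : Module.finrank K L = 3) (d y : Fin n → L) :
    (stepT A Ω x d y).cost = 3 * Ω + n * (3 * extPrice) := by
  simp [stepT, blackBoxT, h3]
  exact Or.inl (by ring)

lemma momentsT_getD (d u : Fin n → L) (m : ℕ) (y : Fin n → L) {i : ℕ} (hi : i < m) :
    (momentsT A Ω x d u m y).val.getD i 0 = moment (precond A x d) u y i := by
  induction m generalizing y i with
  | zero => omega
  | succ m ih =>
    cases i with
    | zero => simp [momentsT, moment, dotProduct]
    | succ i =>
      simp only [momentsT, Timed.val_bind, Timed.val_pure, List.getD_cons_succ]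
      rw [ih _ (by omega), stepT_val, moment, moment, Matrix.mulVec_mulVec, ← pow_succ]

lemma momentsT_cost (h3 : Module.finrank K L = 3) (d u : Fin n → L) (m : ℕ) (y : Fin n → L) :
    (momentsT A Ω x d u m y).cost = m * (3 * Ω + n * (5 * extPrice)) := by
  induction m generalizing y with
  | zero => simp [momentsT]
  | succ m ih => simp [momentsT, ih, stepT_cost A Ω x h3]; ring

lemma det_precond (d : Fin n → L) :
    (precond A x d).det = (∏ i, d i) * algebraMap K L (A.charpoly.eval x) := by
  rw [precond, Matrix.det_mul, Matrix.det_diagonal, Matrix.eval_charpoly, RingHom.map_det]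
  rfl

/-- The characteristic polynomial is orthogonal to all monomials of degree less than `n`, by the
Cayley-Hamilton theorem. -/
lemma pairing_charpoly {s : ℕ → L} (M : Matrix (Fin n) (Fin n) L) (u v : Fin n → L)
    (hs : ∀ i < 2 * n, s i = moment M u v i) {i : ℕ} (hi : i < n) :
    pairing s (fun c : Fin (n + 1) => M.charpoly.coeff c) i = 0 := by
  have h1 : ∑ c ∈ Finset.range (n + 1), M.charpoly.coeff c • M ^ c = 0 := by
    rw [← Matrix.aeval_self_charpoly M, aeval_eq_sum_range, Matrix.charpoly_natDegree_eq_dim,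
      Fintype.card_fin]
  have h2 : ∀ c : Fin (n + 1), M.charpoly.coeff c * s ((c : ℕ) + i) =
      u ⬝ᵥ ((M.charpoly.coeff c • M ^ (c : ℕ)) * M ^ i).mulVec v := by
    intro c
    rw [hs _ (by have := c.2; omega), moment, Matrix.smul_mul, Matrix.smul_mulVec,
      dotProduct_smul, smul_eq_mul, pow_add]
  simp only [pairing, h2]
  rw [← dotProduct_sum, ← Matrix.sum_mulVec, ← Finset.sum_mul,
    Fin.sum_univ_eq_sum_range (fun c => M.charpoly.coeff c • M ^ c), h1]
  simp

lemma orthT_cur_zero {s : ℕ → L} (M : Matrix (Fin n) (Fin n) L) (u v : Fin n → L)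
    (hs : ∀ i < 2 * n, s i = moment M u v i) {σ : OrthState n L}
    (h : (orthT n s n).val = some σ) : σ.cur 0 = M.charpoly.coeff 0 := by
  have hO := orthT_isOrthogonal le_rfl h
  have h1 := eq_zero_of_pairing_eq_zero (w := fun c => σ.cur c - M.charpoly.coeff c) h ?_ ?_
  · simpa [sub_eq_zero] using congrFun h1 0
  · have h2 : M.charpoly.coeff n = 1 := by
      have := (Matrix.charpoly_monic M).coeff_natDegree
      rwa [Matrix.charpoly_natDegree_eq_dim, Fintype.card_fin] at this
    simp [hO.cur_eq_one (Fin.last n) rfl, h2]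
  · intro i hi
    rw [pairing_sub, hO.cur_orth i hi, pairing_charpoly M u v hs hi, sub_zero]

open Classical in
lemma detTryT_val (r : Fin 3 → Fin n → L) :
    (detTryT A Ω x r).val = if ∏ i, r 0 i = 0 then none else
      (orthT n (fun i => (momentsT A Ω x (r 0) (r 1) (2 * n) (r 2)).val.getD i 0) n).val.map
        fun σ => Function.invFun (algebraMap K L) ((-1) ^ n * σ.cur 0 / ∏ i, r 0 i) := by
  simp only [detTryT, Timed.val_bind, forT_val, drawT_val, prodT_val, isZeroT_val]
  by_cases h : ∏ i, r 0 i = 0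
  · simp [h]
  · simp only [h, decide_false, if_false, Timed.val_bind]
    cases (orthT n (fun i => (momentsT A Ω x (r 0) (r 1) (2 * n) (r 2)).val.getD i 0) n).val <;>
      simp

/-- A successful attempt returns the determinant of `x • 1 - A`. -/
lemma detTryT_eq_some {r : Fin 3 → Fin n → L} {t : K} (h : (detTryT A Ω x r).val = some t) :
    t = A.charpoly.eval x := by
  classical
  rw [detTryT_val] at h
  split_ifs at h with h0
  obtain ⟨σ, hσ, rfl⟩ := Option.map_eq_some_iff.1 h
  rw [orthT_cur_zero (precond A x (r 0)) (r 1) (r 2)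
    (fun i hi => momentsT_getD A Ω x _ _ _ _ hi) hσ]
  have h1 := Matrix.det_eq_sign_charpoly_coeff (precond A x (r 0))
  rw [Fintype.card_fin] at h1
  rw [← h1, det_precond, mul_div_cancel_left₀ _ h0]
  exact Function.leftInverse_invFun (algebraMap K L).injective _

lemma detTryT_isSome {r : Fin 3 → Fin n → L} (hd : ∀ i, r 0 i ≠ 0)
    (hH : ∀ i < n, (hankel (moment (precond A x (r 0)) (r 1) (r 2)) (i + 1)).det ≠ 0) :
    (detTryT A Ω x r).val.isSome = true := by
  classical
  rw [detTryT_val, if_neg (Finset.prod_ne_zero_iff.2 fun i _ => hd i), Option.isSome_map]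
  rw [Option.isSome_iff_ne_none]
  intro hnone
  obtain ⟨i, hi, h0⟩ := exists_det_hankel_eq_zero le_rfl hnone
  refine hH i hi ?_
  rw [← h0]
  congr 1
  ext a b
  simp only [hankel, Matrix.of_apply]
  rw [momentsT_getD A Ω x _ _ _ _ (by have := a.2; have := b.2; omega)]

lemma detTryT_cost_le (h3 : Module.finrank K L = 3) (hn : 1 ≤ n) (hΩ : n ≤ Ω)
    (r : Fin 3 → Fin n → L) : (detTryT A Ω x r).cost ≤ 8000 * (n * Ω) := by
  have h1 : (detTryT A Ω x r).cost ≤ 4 * (n * extPrice) + extPrice +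
      2 * n * (3 * Ω + n * (5 * extPrice)) + n * ((n + 1) * (8 * extPrice) + 4 * extPrice) +
        (n * extPrice + 2 * extPrice) := by
    simp only [detTryT, Timed.cost_bind, forT_cost, drawT_cost, prodT_cost, isZeroT_cost]
    simp only [Finset.sum_const, Finset.card_univ, Fintype.card_fin, smul_eq_mul]
    split
    · simp only [Timed.cost_pure]
      generalize 2 * n * (3 * Ω + n * (5 * extPrice)) = a
      generalize n * ((n + 1) * (8 * extPrice) + 4 * extPrice) = b
      omega
    · simp only [Timed.cost_bind, momentsT_cost A Ω x h3]
      grw [orthT_cost_le]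
      generalize 2 * n * (3 * Ω + n * (5 * extPrice)) = a
      generalize n * ((n + 1) * (8 * extPrice) + 4 * extPrice) = b
      split
      · simp only [Timed.cost_pure]
        omega
      · simp only [Timed.cost_bind, Timed.cost_pure, prodT_cost, mulT_cost, divT_cost]
        omega
  refine h1.trans ?_
  simp only [extPrice]
  have hΩ1 : 1 ≤ Ω := hn.trans hΩ
  have h2 : n ≤ n * Ω := Nat.le_mul_of_pos_right _ hΩ1
  have h4 : n * n ≤ n * Ω := Nat.mul_le_mul_left _ hΩ
  nlinarith

end DetTry

/-! ### Generic diagonal preconditioners -/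

section Generic

open scoped Matrix

variable {n : ℕ} {F : Type} [Field F]

/-- For every scalar `l`, the solutions of `N w = l • (e * w)` form a space of dimension at most
one. -/
def HasLineEigenspaces (N : Matrix (Fin n) (Fin n) F) (e : Fin n → F) : Prop :=
  ∀ (l : F) (w y : Fin n → F), N *ᵥ w = l • (e * w) → N *ᵥ y = l • (e * y) → w ≠ 0 →
    ∃ t : F, y = t • w

lemma eq_zero_of_mulVec_eq_zero {N : Matrix (Fin n) (Fin n) F} (hN : N.det ≠ 0) {w : Fin n → F}
    (h : N *ᵥ w = 0) : w = 0 := by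
  by_contra hw
  exact hN (Matrix.exists_mulVec_eq_zero_iff.1 ⟨w, hw, h⟩)

lemma finite_pencil_eigenvalues {N : Matrix (Fin n) (Fin n) F} (hN : N.det ≠ 0) (e : Fin n → F) :
    {l : F | ∃ w, w ≠ 0 ∧ N *ᵥ w = l • (e * w)}.Finite := by
  classical
  set D : F[X] := (N.map C - Matrix.diagonal fun i => X * C (e i)).det with hD
  have heval : ∀ l : F, D.eval l = (N - Matrix.diagonal fun i => l * e i).det := by
    intro l
    rw [← coe_evalRingHom, hD, RingHom.map_det]
    congr 1
    ext a b
    rcases eq_or_ne a b with rfl | hab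
    · simp [mul_comm l]
    · simp [hab]
  have hD0 : D ≠ 0 := by
    intro h
    have := heval 0
    simp [h] at this
    exact hN this.symm
  refine (D.roots.toFinset.finite_toSet).subset ?_
  rintro l ⟨w, hw, h⟩
  rw [Finset.mem_coe, Multiset.mem_toFinset, mem_roots hD0, IsRoot, heval]
  refine Matrix.exists_mulVec_eq_zero_iff.1 ⟨w, hw, ?_⟩
  rw [Matrix.sub_mulVec, h]
  ext i
  simp [Matrix.mulVec_diagonal, mul_assoc]

/-- If the property fails at `l` after the entry `j` of `e` has been changed from `0` to `c`, then
`l` is an eigenvalue of the old pencil, and `N y = l • (e * y) + l * c` (in coordinate `j`) has a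
solution with `y j = 1`. -/
lemma exists_of_not_line {N : Matrix (Fin n) (Fin n) F} {e : Fin n → F}
    (he : HasLineEigenspaces N e) {j : Fin n} {c l : F} {w y : Fin n → F}
    (hw : N *ᵥ w = l • (Function.update e j c * w))
    (hy : N *ᵥ y = l • (Function.update e j c * y)) (hwy : ∀ t : F, y ≠ t • w) (hw0 : w ≠ 0) :
    (∃ w', w' ≠ 0 ∧ w' j = 0 ∧ N *ᵥ w' = l • (e * w')) ∧
      ∃ y', y' j = 1 ∧ N *ᵥ y' = l • (Function.update e j c * y') := by
  have key : ∀ z : Fin n → F, z j = 0 → Function.update e j c * z = e * z := by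
    intro z hz
    ext i
    by_cases hi : i = j
    · subst hi; simp [hz]
    · simp [Function.update_of_ne hi]
  have hscale : ∀ z : Fin n → F, z j ≠ 0 → N *ᵥ z = l • (Function.update e j c * z) →
      ∃ y', y' j = 1 ∧ N *ᵥ y' = l • (Function.update e j c * y') := by
    intro z hz h
    refine ⟨(z j)⁻¹ • z, by simp [hz], ?_⟩
    rw [Matrix.mulVec_smul, h, mul_smul_comm, smul_comm]
  by_cases h1 : w j = 0
  · have h2 : N *ᵥ w = l • (e * w) := by rw [hw, key w h1]
    refine ⟨⟨w, hw0, h1, h2⟩, hscale y (fun h3 => ?_) hy⟩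
    obtain ⟨t, ht⟩ := he l w y h2 (by rw [hy, key y h3]) hw0
    exact hwy t ht
  · refine ⟨⟨y - (y j / w j) • w, sub_ne_zero.2 (hwy _), by simp [h1], ?_⟩, hscale w h1 hw⟩
    rw [← key _ (by simp [h1]), Matrix.mulVec_sub, Matrix.mulVec_smul, hw, hy, mul_sub, smul_sub,
      mul_smul_comm, smul_comm l]

/-- A zero entry of the diagonal can be made nonzero: for each of the finitely many eigenvalues of
the pencil, at most one new value of the entry is bad. -/
lemma HasLineEigenspaces.exists_update [Infinite F] {N : Matrix (Fin n) (Fin n) F}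
    (hN : N.det ≠ 0) {e : Fin n → F} (he : HasLineEigenspaces N e) {j : Fin n} (hj : e j = 0) :
    ∃ c : F, c ≠ 0 ∧ HasLineEigenspaces N (Function.update e j c) := by
  set S := {l : F | ∃ w, w ≠ 0 ∧ N *ᵥ w = l • (e * w)}
  set bad : F → Set F := fun l => {c | ∃ w y, N *ᵥ w = l • (Function.update e j c * w) ∧
    N *ᵥ y = l • (Function.update e j c * y) ∧ w ≠ 0 ∧ ∀ t : F, y ≠ t • w}
  have hsub : ∀ l ∈ S, (bad l).Subsingleton := by
    rintro l ⟨w₁, hw₁, hl⟩ c ⟨w, y, hw, hy, hw0, hwy⟩ c' ⟨w', y', hw', hy', hw0', hwy'⟩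
    have hl0 : l ≠ 0 := by
      rintro rfl
      exact hw₁ (eq_zero_of_mulVec_eq_zero hN (by simpa using hl))
    obtain ⟨⟨v, hv0, hvj, hv⟩, z, hzj, hz⟩ := exists_of_not_line he hw hy hwy hw0
    obtain ⟨-, z', hzj', hz'⟩ := exists_of_not_line he hw' hy' hwy' hw0'
    obtain ⟨t, ht⟩ := he l v (c' • z - c • z') hv (by
      rw [Matrix.mulVec_sub, Matrix.mulVec_smul, Matrix.mulVec_smul, hz, hz']
      ext i
      by_cases hi : i = j
      · subst hi
        simp [hj, hzj, hzj']
        ring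
      · simp [Function.update_of_ne hi]
        ring) hv0
    have := congrFun ht j
    simp [hzj, hzj', hvj] at this
    exact (sub_eq_zero.1 this).symm
  have hfin : ({0} ∪ ⋃ l ∈ S, bad l).Finite :=
    (Set.finite_singleton 0).union
      ((finite_pencil_eigenvalues hN e).biUnion fun l hl => (hsub l hl).finite)
  obtain ⟨c, hc⟩ := hfin.exists_notMem
  rw [Set.mem_union, not_or] at hc
  refine ⟨c, hc.1, fun l w y hw hy hw0 => ?_⟩
  by_contra! hwy
  obtain ⟨⟨v, hv0, -, hv⟩, -⟩ := exists_of_not_line he hw hy hwy hw0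
  exact hc.2 (Set.mem_biUnion (x := l) ⟨v, hv0, hv⟩ ⟨w, y, hw, hy, hw0, hwy⟩)

lemma exists_hasLineEigenspaces [Infinite F] {N : Matrix (Fin n) (Fin n) F} (hN : N.det ≠ 0) :
    ∃ e : Fin n → F, (∀ i, e i ≠ 0) ∧ HasLineEigenspaces N e := by
  have key : ∀ s : Finset (Fin n), ∃ e : Fin n → F, (∀ i ∈ s, e i ≠ 0) ∧
      HasLineEigenspaces N e := by
    intro s
    induction s using Finset.induction_on with
    | empty =>
      refine ⟨0, by simp, fun l w y hw _ hw0 => ?_⟩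
      exact absurd (eq_zero_of_mulVec_eq_zero hN (by simpa using hw)) hw0
    | insert j s hj ih =>
      obtain ⟨e, hes, he⟩ := ih
      by_cases h : e j = 0
      · obtain ⟨c, hc, h'⟩ := he.exists_update hN h
        refine ⟨_, fun i hi => ?_, h'⟩
        by_cases hij : i = j
        · subst hij; simpa using hc
        · rw [Function.update_of_ne hij]
          exact hes i ((Finset.mem_insert.1 hi).resolve_left hij)
      · refine ⟨e, fun i hi => ?_, he⟩
        rcases Finset.mem_insert.1 hi with rfl | hi
        exacts [h, hes i hi]
  obtain ⟨e, h1, h2⟩ := key Finset.univ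
  exact ⟨e, fun i => h1 i (Finset.mem_univ i), h2⟩

/-- Over an infinite field, some linear form does not vanish at any of finitely many nonzero
vectors. -/
lemma exists_dotProduct_ne_zero [Infinite F] {S : Set F} (hS : S.Finite) (w : F → Fin n → F)
    (hw : ∀ l ∈ S, w l ≠ 0) : ∃ u : Fin n → F, ∀ l ∈ S, u ⬝ᵥ w l ≠ 0 := by
  classical
  set q : F → F[X] := fun l => ∑ i, C (w l i) * X ^ (i : ℕ) with hq
  have hcoeff : ∀ l (i : Fin n), (q l).coeff i = w l i := by
    intro l i
    simp only [hq, finsetSum_coeff, coeff_C_mul, coeff_X_pow]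
    rw [Finset.sum_eq_single i]
    · simp
    · intro a _ ha
      rw [if_neg (fun h => ha (Fin.ext h.symm)), mul_zero]
    · simp
  have hq0 : ∏ l ∈ hS.toFinset, q l ≠ 0 := by
    refine Finset.prod_ne_zero_iff.2 fun l hl h => hw l (hS.mem_toFinset.1 hl) ?_
    ext i
    rw [← hcoeff, h, coeff_zero, Pi.zero_apply]
  obtain ⟨t, ht⟩ : ∃ t : F, (∏ l ∈ hS.toFinset, q l).eval t ≠ 0 := by
    by_contra! h
    exact hq0 (Polynomial.funext fun t => by rw [h t, eval_zero])
  refine ⟨fun i => t ^ (i : ℕ), fun l hl => ?_⟩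
  rw [eval_prod, Finset.prod_ne_zero_iff] at ht
  have := ht l (hS.mem_toFinset.2 hl)
  simp only [hq, eval_finsetSum, eval_mul, eval_C, eval_pow, eval_X] at this
  rw [dotProduct]
  convert! this using 2 with i
  ring

/-- Popov-Belevitch-Hautus: if the eigenspaces of a matrix are lines, then some linear form sees
every nonzero vector along its orbit. -/
lemma exists_observable [IsAlgClosed F] {M : Matrix (Fin n) (Fin n) F}
    (hM : ∀ (l : F) (w y : Fin n → F), M *ᵥ w = l • w → M *ᵥ y = l • y → w ≠ 0 →
      ∃ t : F, y = t • w) :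
    ∃ u : Fin n → F, ∀ w, (∀ i < n, u ⬝ᵥ (M ^ i *ᵥ w) = 0) → w = 0 := by
  classical
  set S : Set F := {l | ∃ w, w ≠ 0 ∧ M *ᵥ w = l • w}
  have hS : S.Finite := by
    refine (M.charpoly.roots.toFinset.finite_toSet).subset ?_
    rintro l ⟨w, hw, h⟩
    rw [Finset.mem_coe, Multiset.mem_toFinset, mem_roots (Matrix.charpoly_monic M).ne_zero, IsRoot,
      Matrix.eval_charpoly]
    refine Matrix.exists_mulVec_eq_zero_iff.1 ⟨w, hw, ?_⟩
    rw [Matrix.sub_mulVec, h, sub_eq_zero]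
    ext i
    simp [Matrix.scalar_apply, Matrix.mulVec_diagonal]
  choose! w hw using fun l (hl : l ∈ S) => hl
  obtain ⟨u, hu⟩ := exists_dotProduct_ne_zero hS w fun l hl => (hw l hl).1
  refine ⟨u, ?_⟩
  -- The vectors on whose orbits `u` vanishes form an invariant subspace without eigenvectors.
  let W : Submodule F (Fin n → F) :=
    { carrier := {y | ∀ i < n, u ⬝ᵥ (M ^ i *ᵥ y) = 0}
      add_mem' := fun {a b} ha hb i hi => by
        rw [Matrix.mulVec_add, dotProduct_add, ha i hi, hb i hi, add_zero]
      zero_mem' := fun i _ => by simp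
      smul_mem' := fun c y hy i hi => by
        rw [Matrix.mulVec_smul, dotProduct_smul, hy i hi, smul_zero] }
  have hinv : ∀ y ∈ W, M.mulVecLin y ∈ W := by
    intro y hy i hi
    rw [Matrix.mulVecLin_apply, Matrix.mulVec_mulVec, ← pow_succ]
    rcases Nat.lt_or_ge (i + 1) n with h | h
    · exact hy _ h
    · have h1 : ∑ c ∈ Finset.range (n + 1), M.charpoly.coeff c • M ^ c = 0 := by
        rw [← Matrix.aeval_self_charpoly M, aeval_eq_sum_range, Matrix.charpoly_natDegree_eq_dim,
          Fintype.card_fin]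
      have h2 : M.charpoly.coeff n = 1 := by
        have := (Matrix.charpoly_monic M).coeff_natDegree
        rwa [Matrix.charpoly_natDegree_eq_dim, Fintype.card_fin] at this
      obtain rfl : i + 1 = n := by omega
      rw [Finset.sum_range_succ, h2, one_smul] at h1
      rw [eq_neg_of_add_eq_zero_right h1, Matrix.neg_mulVec, dotProduct_neg, Matrix.sum_mulVec,
        dotProduct_sum, neg_eq_zero]
      refine Finset.sum_eq_zero fun c hc => ?_
      rw [Matrix.smul_mulVec, dotProduct_smul, hy c (Finset.mem_range.1 hc), smul_zero]
  intro y hy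
  by_contra hy0
  have : Nontrivial W := ⟨⟨⟨y, hy⟩, 0, fun h => hy0 (congrArg Subtype.val h)⟩⟩
  obtain ⟨l, hl⟩ := Module.End.exists_eigenvalue (M.mulVecLin.restrict hinv)
  obtain ⟨z, hz⟩ := hl.exists_hasEigenvector
  have hz0 : (z : Fin n → F) ≠ 0 := fun h => hz.2 (Subtype.ext h)
  have hzl : M *ᵥ (z : Fin n → F) = l • (z : Fin n → F) := congrArg Subtype.val hz.apply_eq_smul
  have hlS : l ∈ S := ⟨z, hz0, hzl⟩
  obtain ⟨t, ht⟩ := hM l z (w l) hzl (hw l hlS).2 hz0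
  have hn : 0 < n := by
    rcases Nat.eq_zero_or_pos n with rfl | h
    · exact absurd (Subsingleton.elim _ _) hy0
    · exact h
  have := z.2 0 hn
  rw [pow_zero, Matrix.one_mulVec] at this
  exact hu l hlS (by rw [ht, dotProduct_smul, this, smul_zero])

/-- A Hankel matrix with zeros above the antidiagonal and ones on it is invertible. -/
lemma det_hankel_ne_zero {s : ℕ → F} {m : ℕ} (h0 : ∀ i < m, s i = 0) (h1 : s m = 1) :
    (hankel s (m + 1)).det ≠ 0 := by
  intro h
  have h2 := Matrix.det_permute' Fin.revPerm (hankel s (m + 1))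
  rw [h, mul_zero, Matrix.det_of_isLowerTriangular] at h2
  · refine one_ne_zero (α := F) ?_
    rw [← h2]
    refine (Finset.prod_eq_one fun a _ => ?_).symm
    simp only [hankel, Matrix.submatrix_apply, id_eq, Fin.revPerm_apply, Matrix.of_apply,
      Fin.val_rev]
    rw [← h1]
    congr 1
    have := a.2
    omega
  · intro a b hab
    have hab : a < b := hab
    simp only [hankel, Matrix.submatrix_apply, id_eq, Fin.revPerm_apply, Matrix.of_apply,
      Fin.val_rev]
    refine h0 _ ?_
    have := b.2
    rw [Fin.lt_def] at hab
    omega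

/-- Over an algebraically closed field, each Hankel determinant of the preconditioned matrix is
nonzero for a suitable choice of the random vectors. -/
lemma exists_det_hankel_ne_zero [IsAlgClosed F] {N : Matrix (Fin n) (Fin n) F} (hN : N.det ≠ 0)
    {m : ℕ} (hm : m < n) :
    ∃ d u v : Fin n → F, (hankel (moment (Matrix.diagonal d * N) u v) (m + 1)).det ≠ 0 := by
  classical
  have : Infinite F := IsAlgClosed.instInfinite
  obtain ⟨e, he0, he⟩ := exists_hasLineEigenspaces hN
  set M := Matrix.diagonal e⁻¹ * N with hMdef
  have hM : ∀ (l : F) (w : Fin n → F), M *ᵥ w = l • w → N *ᵥ w = l • (e * w) := by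
    intro l w h
    rw [hMdef, ← Matrix.mulVec_mulVec] at h
    ext i
    have := congrFun h i
    rw [Matrix.mulVec_diagonal, Pi.inv_apply, inv_mul_eq_iff_eq_mul₀ (he0 i)] at this
    rw [this]
    simp
    ring
  obtain ⟨u, hu⟩ := exists_observable fun l w y hw hy => he l w y (hM l w hw) (hM l y hy)
  let T : (Fin n → F) →ₗ[F] (Fin n → F) :=
    { toFun := fun w i => u ⬝ᵥ (M ^ (i : ℕ) *ᵥ w)
      map_add' := fun a b => by ext i; simp [Matrix.mulVec_add]
      map_smul' := fun c a => by ext i; simp [Matrix.mulVec_smul] }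
  have hT : Function.Injective T := by
    refine (injective_iff_map_eq_zero T).2 fun w hw => hu w fun i hi => ?_
    exact congrFun hw ⟨i, hi⟩
  obtain ⟨v, hv⟩ := LinearMap.injective_iff_surjective.1 hT (Pi.single ⟨m, hm⟩ 1)
  refine ⟨e⁻¹, u, v, det_hankel_ne_zero (fun i hi => ?_) ?_⟩
  · have := congrFun hv ⟨i, hi.trans hm⟩
    rwa [Pi.single_eq_of_ne (by simpa using hi.ne)] at this
  · have := congrFun hv ⟨m, hm⟩
    rwa [Pi.single_eq_same] at this

end Generic

/-! ### The success probability of one attempt -/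

section Count

/-- The lemma of Schwartz and Zippel for uniform points of a finite field. -/
lemma card_eval_eq_zero_mul_le {σ : Type} [Fintype σ] {L : Type} [Field L] [Fintype L]
    {f : MvPolynomial σ L} (hf : f ≠ 0) :
    Nat.card {y : σ → L // MvPolynomial.eval y f = 0} * Fintype.card L ≤
      f.totalDegree * Nat.card (σ → L) := by
  classical
  set e := Fintype.equivFin σ
  have h0 : MvPolynomial.rename e f ≠ 0 := fun h =>
    hf (MvPolynomial.rename_injective e e.injective (by rw [h, map_zero]))
  have h1 := MvPolynomial.schwartz_zippel_totalDegree h0 (Finset.univ : Finset L)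
  have hL : (0 : ℚ≥0) < Fintype.card L := by exact_mod_cast Fintype.card_pos
  rw [Finset.card_univ, div_le_div_iff₀ (by positivity) hL] at h1
  have h2 : Nat.card {y : σ → L // MvPolynomial.eval y f = 0} =
      (Finset.filter (fun y => MvPolynomial.eval y (MvPolynomial.rename e f) = 0)
        (Fintype.piFinset fun _ : Fin (Fintype.card σ) => (Finset.univ : Finset L))).card := by
    rw [Fintype.piFinset_univ, ← Fintype.card_subtype, ← Nat.card_eq_fintype_card]
    refine Nat.card_congr ((Equiv.arrowCongr e (Equiv.refl L)).subtypeEquiv fun y => ?_)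
    rw [MvPolynomial.eval_rename]
    have : (Equiv.arrowCongr e (Equiv.refl L) y) ∘ e = y := by ext; simp [Equiv.arrowCongr]
    rw [this]
  have h3 : Nat.card (σ → L) = Fintype.card L ^ Fintype.card σ := by
    rw [Nat.card_eq_fintype_card, Fintype.card_fun]
  rw [h2, h3]
  have h4 : ((Finset.filter (fun y => MvPolynomial.eval y (MvPolynomial.rename e f) = 0)
        (Fintype.piFinset fun _ : Fin (Fintype.card σ) => (Finset.univ : Finset L))).card *
          Fintype.card L : ℕ) ≤
      (MvPolynomial.rename e f).totalDegree * Fintype.card L ^ Fintype.card σ := by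
    exact_mod_cast h1
  exact h4.trans (Nat.mul_le_mul_right _ (MvPolynomial.totalDegree_rename_le _ _))

open MvPolynomial (totalDegree)

variable {n : ℕ} {K L : Type} [Field K] [Field L] [Algebra K L]

section Map

variable {R S : Type} [CommRing R] [CommRing S] (φ : R →+* S)

lemma map_moment (M : Matrix (Fin n) (Fin n) R) (u v : Fin n → R) (i : ℕ) :
    φ (moment M u v i) = moment (M.map φ) (φ ∘ u) (φ ∘ v) i := by
  have : (M.map φ) ^ i = (M ^ i).map φ := (map_pow φ.mapMatrix M i).symm
  rw [moment, moment, RingHom.map_dotProduct, this]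
  congr 1
  ext j
  simp [RingHom.map_mulVec]

lemma map_det_hankel (s : ℕ → R) (m : ℕ) : φ (hankel s m).det = (hankel (φ ∘ s) m).det := by
  rw [RingHom.map_det]
  rfl

end Map

/-- The matrix `diag(d) * N` whose diagonal entries `d i` are indeterminates. -/
noncomputable def genericPrecond (N : Matrix (Fin n) (Fin n) L) :
    Matrix (Fin n) (Fin n) (MvPolynomial (Fin 3 × Fin n) L) :=
  Matrix.diagonal (fun i => MvPolynomial.X (0, i)) * N.map MvPolynomial.C

/-- The moments of the generic preconditioned matrix for generic vectors. -/
noncomputable def genericMoment (N : Matrix (Fin n) (Fin n) L) :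
    ℕ → MvPolynomial (Fin 3 × Fin n) L :=
  moment (genericPrecond N) (fun i => MvPolynomial.X (1, i)) (fun i => MvPolynomial.X (2, i))

/-- The attempt with the random vectors `d, u, v` succeeds wherever this polynomial does not
vanish. -/
noncomputable def successPoly (N : Matrix (Fin n) (Fin n) L) : MvPolynomial (Fin 3 × Fin n) L :=
  (∏ i, MvPolynomial.X (0, i)) * ∏ m ∈ Finset.range n, (hankel (genericMoment N) (m + 1)).det

lemma map_genericMoment {S : Type} [CommRing S] (φ : MvPolynomial (Fin 3 × Fin n) L →+* S)
    (N : Matrix (Fin n) (Fin n) L) (i : ℕ) :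
    φ (genericMoment N i) =
      moment (Matrix.diagonal (fun i => φ (MvPolynomial.X (0, i))) *
        N.map (φ.comp MvPolynomial.C)) (fun i => φ (MvPolynomial.X (1, i)))
          (fun i => φ (MvPolynomial.X (2, i))) i := by
  rw [genericMoment, map_moment, genericPrecond, Matrix.map_mul, Matrix.diagonal_map (map_zero φ),
    Matrix.map_map]
  rfl

lemma successPoly_ne_zero {N : Matrix (Fin n) (Fin n) L} (hN : N.det ≠ 0) :
    successPoly N ≠ 0 := by
  refine mul_ne_zero (Finset.prod_ne_zero_iff.2 fun i _ => MvPolynomial.X_ne_zero _)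
    (Finset.prod_ne_zero_iff.2 fun m hm h => ?_)
  have hN' : (N.map (algebraMap L (AlgebraicClosure L))).det ≠ 0 := by
    have := RingHom.map_det (algebraMap L (AlgebraicClosure L)) N
    rw [RingHom.mapMatrix_apply] at this
    rw [← this]
    simpa using hN
  obtain ⟨d, u, v, hne⟩ := exists_det_hankel_ne_zero hN' (Finset.mem_range.1 hm)
  set φ : MvPolynomial (Fin 3 × Fin n) L →+* AlgebraicClosure L :=
    MvPolynomial.eval₂Hom (algebraMap L (AlgebraicClosure L))
      (fun j => (![d, u, v] : Fin 3 → Fin n → AlgebraicClosure L) j.1 j.2) with hφ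
  have h1 := map_det_hankel φ (genericMoment N) (m + 1)
  rw [h, map_zero] at h1
  apply hne
  rw [h1]
  congr 2
  ext i
  rw [Function.comp_apply, map_genericMoment]
  have hC : φ.comp MvPolynomial.C = algebraMap L (AlgebraicClosure L) := by
    ext a; simp [hφ]
  rw [hC]
  simp [hφ]

lemma totalDegree_mulVec_le {σ : Type} {R : Type} [CommRing R]
    {M : Matrix (Fin n) (Fin n) (MvPolynomial σ R)} {y : Fin n → MvPolynomial σ R} {a b : ℕ}
    (hM : ∀ i j, (M i j).totalDegree ≤ a) (hy : ∀ j, (y j).totalDegree ≤ b) (i : Fin n) :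
    (M.mulVec y i).totalDegree ≤ a + b :=
  MvPolynomial.totalDegree_finsetSum_le fun j _ =>
    (MvPolynomial.totalDegree_mul _ _).trans (add_le_add (hM i j) (hy j))

lemma totalDegree_genericMoment_le (N : Matrix (Fin n) (Fin n) L) (i : ℕ) :
    (genericMoment N i).totalDegree ≤ i + 2 := by
  have hX : ∀ j : Fin 3 × Fin n, (MvPolynomial.X j : MvPolynomial _ L).totalDegree ≤ 1 :=
    fun j => (MvPolynomial.totalDegree_X j).le
  have hM : ∀ a b, (genericPrecond N a b).totalDegree ≤ 1 := by
    intro a b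
    rw [genericPrecond, Matrix.diagonal_mul]
    refine (MvPolynomial.totalDegree_mul _ _).trans ?_
    simp
  have hv : ∀ a, ((genericPrecond N ^ i).mulVec (fun i => MvPolynomial.X (2, i)) a).totalDegree ≤
      i + 1 := by
    induction i with
    | zero => intro a; simp
    | succ i ih =>
      intro a
      rw [pow_succ', ← Matrix.mulVec_mulVec]
      exact (totalDegree_mulVec_le hM ih a).trans (by omega)
  exact MvPolynomial.totalDegree_finsetSum_le fun a _ =>
    (MvPolynomial.totalDegree_mul _ _).trans ((add_le_add (hX _) (hv a)).trans (by omega))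

lemma totalDegree_det_hankel_le (N : Matrix (Fin n) (Fin n) L) (m : ℕ) :
    (hankel (genericMoment N) m).det.totalDegree ≤ m * (m + 1) := by
  rw [Matrix.det_apply]
  refine MvPolynomial.totalDegree_finsetSum_le fun σ _ => ?_
  have hs : ∀ (z : ℤˣ) (f : MvPolynomial (Fin 3 × Fin n) L),
      (z • f).totalDegree ≤ f.totalDegree := by
    intro z f
    rcases Int.units_eq_one_or z with rfl | rfl <;> simp
  refine (hs _ _).trans ((MvPolynomial.totalDegree_finsetProd _ _).trans ?_)
  calc ∑ a, (hankel (genericMoment N) m (σ a) a).totalDegree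
      ≤ ∑ a : Fin m, (((σ a : Fin m) : ℕ) + (a : ℕ) + 2) :=
        Finset.sum_le_sum fun a _ => totalDegree_genericMoment_le N _
    _ = 2 * ∑ a : Fin m, (a : ℕ) + m * 2 := by
        rw [Finset.sum_add_distrib, Finset.sum_add_distrib,
          Equiv.sum_comp σ (fun a : Fin m => (a : ℕ))]
        simp
        ring
    _ = m * (m + 1) := by
        rw [Fin.sum_univ_eq_sum_range (fun a => a) m, mul_comm 2, Finset.sum_range_id_mul_two]
        cases m with
        | zero => rfl
        | succ m => simp; ring

lemma totalDegree_successPoly_le (N : Matrix (Fin n) (Fin n) L) :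
    3 * (successPoly N).totalDegree ≤ (n + 2) ^ 3 := by
  have h1 : (successPoly N).totalDegree ≤ n + ∑ m ∈ Finset.range n, (m + 1) * (m + 2) := by
    refine (MvPolynomial.totalDegree_mul _ _).trans (add_le_add ?_ ?_)
    · refine (MvPolynomial.totalDegree_finsetProd _ _).trans ?_
      simp
    · refine (MvPolynomial.totalDegree_finsetProd _ _).trans (Finset.sum_le_sum fun m _ => ?_)
      exact totalDegree_det_hankel_le N (m + 1)
  have h2 : ∀ k : ℕ, 3 * ∑ m ∈ Finset.range k, (m + 1) * (m + 2) = k * (k + 1) * (k + 2) := by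
    intro k
    induction k with
    | zero => rfl
    | succ k ih => rw [Finset.sum_range_succ, mul_add, ih]; ring
  have h3 := h2 n
  nlinarith

/-- At most a third of the random choices make an attempt fail. -/
lemma card_detTryT_eq_none_le [Fintype K] [Fintype L] (h3 : Module.finrank K L = 3)
    (hn : n + 2 ≤ Fintype.card K) (A : Matrix (Fin n) (Fin n) K) (Ω : ℕ) {x : K}
    (hx : A.charpoly.eval x ≠ 0) :
    3 * Nat.card {y : Fin 3 × Fin n → L // (detTryT A Ω x fun a c => y (a, c)).val = none} ≤
      Nat.card (Fin 3 × Fin n → L) := by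
  classical
  set N := (Matrix.scalar (Fin n) x - A).map (algebraMap K L) with hNdef
  have hN : N.det ≠ 0 := by
    have h := RingHom.map_det (algebraMap K L) (Matrix.scalar (Fin n) x - A)
    rw [← Matrix.eval_charpoly, RingHom.mapMatrix_apply] at h
    rw [hNdef, ← h]
    simpa using hx
  have h1 : Nat.card {y : Fin 3 × Fin n → L // (detTryT A Ω x fun a c => y (a, c)).val = none} ≤
      Nat.card {y : Fin 3 × Fin n → L // MvPolynomial.eval y (successPoly N) = 0} := by
    refine Nat.card_le_card_of_injective
      (Subtype.map id fun y hy => ?_) (Subtype.map_injective _ Function.injective_id)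
    by_contra hne
    rw [id_eq, successPoly, map_mul, ← ne_eq, mul_ne_zero_iff, map_prod, map_prod,
      Finset.prod_ne_zero_iff, Finset.prod_ne_zero_iff] at hne
    have hs := detTryT_isSome A Ω x (r := fun a c => y (a, c))
      (fun i => by simpa using hne.1 i (Finset.mem_univ i)) (fun i hi => by
        have := hne.2 i (Finset.mem_range.2 hi)
        rw [map_det_hankel] at this
        convert! this using 3
        ext j
        rw [Function.comp_apply, map_genericMoment]
        have hC : (MvPolynomial.eval y).comp MvPolynomial.C = RingHom.id L := by
          ext a; simp
        rw [hC]
        simp [precond, hNdef])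
    rw [hy] at hs
    exact Bool.false_ne_true hs
  have h2 := card_eval_eq_zero_mul_le (successPoly_ne_zero hN)
  have hL : Fintype.card L = Fintype.card K ^ 3 := by
    rw [Module.card_eq_pow_finrank (K := K), h3]
  have h4 : (n + 2) ^ 3 ≤ Fintype.card L := hL ▸ Nat.pow_le_pow_left hn 3
  have h5 := totalDegree_successPoly_le N
  have hLpos : 0 < Fintype.card L := Fintype.card_pos
  refine Nat.le_of_mul_le_mul_right (?_ : _ * Fintype.card L ≤ _ * Fintype.card L) hLpos
  calc _ ≤ 3 * (Nat.card {y : Fin 3 × Fin n → L // MvPolynomial.eval y (successPoly N) = 0} *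
        Fintype.card L) := by rw [mul_assoc]; gcongr
    _ ≤ 3 * ((successPoly N).totalDegree * Nat.card (Fin 3 × Fin n → L)) := by gcongr
    _ = (3 * (successPoly N).totalDegree) * Nat.card (Fin 3 × Fin n → L) := by ring
    _ ≤ Fintype.card L * Nat.card (Fin 3 × Fin n → L) := by gcongr; exact h5.trans h4
    _ = _ := mul_comm _ _

end Count

/-! ### Repeated independent attempts -/

section Probability

open Classical in
/-- The number of attempts that are made if the attempt number `s` fails under the condition
`fail s`: the attempt number `t` is made if all the earlier ones failed. -/
noncomputable def attempts (fail : ℕ → Prop) : ℝ≥0∞ := ∑' t : ℕ, if ∀ s < t, fail s then 1 else 0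

lemma le_attempts {fail : ℕ → Prop} {T : ℕ} (h : ∀ s < T, fail s) :
    ((T + 1 : ℕ) : ℝ≥0∞) ≤ attempts fail := by
  refine le_trans ?_ (ENNReal.sum_le_tsum (Finset.range (T + 1)))
  rw [Finset.sum_congr rfl fun t ht => if_pos fun s hs =>
    h s (by have := Finset.mem_range.1 ht; omega)]
  simp

lemma attempts_eq_top {fail : ℕ → Prop} (h : ∀ s, fail s) : attempts fail = ⊤ := by
  rw [attempts, tsum_congr fun t => if_pos fun s _ => h s]
  exact ENNReal.tsum_const_eq_top_of_ne_zero one_ne_zero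

lemma repeatUntil_cost_le {α : Type} {f : ℕ → Timed (Option α)} {c : ℕ} (hc : 0 < c)
    (hf : ∀ t, (f t).cost ≤ c) :
    ((repeatUntil f).cost : ℝ≥0∞) ≤ c * attempts fun s => (f s).val = none := by
  classical
  by_cases h : ∃ t, (f t).val.isSome = true
  · have h1 : (repeatUntil f).cost =
        ((∑ s ∈ Finset.range (Nat.find h + 1), (f s).cost : ℕ) : ℕ∞) := by
      simp only [repeatUntil, dif_pos h]
    rw [h1, ENat.toENNReal_coe]
    have h2 : ((Nat.find h + 1 : ℕ) : ℝ≥0∞) ≤ attempts fun s => (f s).val = none := by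
      refine le_attempts fun s hs => ?_
      simpa using Nat.find_min h hs
    calc ((∑ s ∈ Finset.range (Nat.find h + 1), (f s).cost : ℕ) : ℝ≥0∞)
        ≤ ((c * (Nat.find h + 1) : ℕ) : ℝ≥0∞) := by
          refine Nat.cast_le.2 ((Finset.sum_le_card_nsmul _ _ c fun s _ => hf s).trans ?_)
          simp [mul_comm]
      _ ≤ _ := by rw [Nat.cast_mul]; gcongr
  · have h2 : attempts (fun s => (f s).val = none) = ⊤ := by
      refine attempts_eq_top fun s => ?_
      simpa using not_exists.1 h s
    rw [h2, ENNReal.mul_top (by exact_mod_cast hc.ne')]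
    exact le_top

lemma repeatUntil_val_eq_some {α : Type} {f : ℕ → Timed (Option α)} {a : α}
    (h : (repeatUntil f).val = some a) :
    ∃ t, (f t).val = some a ∧ ∀ s < t, (f s).val = none := by
  classical
  by_cases hex : ∃ t, (f t).val.isSome = true
  · have h1 : (repeatUntil f).val = (f (Nat.find hex)).val := by
      simp only [repeatUntil, dif_pos hex]
    refine ⟨_, h1.symm.trans h, fun s hs => ?_⟩
    simpa using Nat.find_min hex hs
  · simp [repeatUntil, dif_neg hex] at h

lemma repeatUntil_val_of_first {α : Type} {f : ℕ → Timed (Option α)} {a : α} {t : ℕ}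
    (ht : (f t).val = some a) (h : ∀ s < t, (f s).val = none) : (repeatUntil f).val = some a := by
  classical
  have hex : ∃ t, (f t).val.isSome = true := ⟨t, by simp [ht]⟩
  have h1 : Nat.find hex = t := by
    refine (Nat.find_eq_iff hex).2 ⟨by simp [ht], fun s hs => by simp [h s hs]⟩
  have h2 : (repeatUntil f).val = (f (Nat.find hex)).val := by
    simp only [repeatUntil, dif_pos hex]
  rw [h2, h1, ht]

lemma repeatUntil_val_isSome {α : Type} {f : ℕ → Timed (Option α)} {t : ℕ}
    (ht : (f t).val ≠ none) : ∃ a, (repeatUntil f).val = some a := by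
  classical
  have hex : ∃ t, (f t).val.isSome = true := ⟨t, Option.isSome_iff_ne_none.2 ht⟩
  have h2 : (repeatUntil f).val = (f (Nat.find hex)).val := by
    simp only [repeatUntil, dif_pos hex]
  obtain ⟨a, ha⟩ := Option.isSome_iff_exists.1 (Nat.find_spec hex)
  exact ⟨a, h2.trans ha⟩

open Measure

section Sequence

variable {Y : Type} [MeasurableSpace Y] (ν : Measure Y) [IsProbabilityMeasure ν]

lemma infinitePi_forall_lt {bad : Set Y} (hb : MeasurableSet bad) (t : ℕ) :
    infinitePi (fun _ : ℕ => ν) {ω | ∀ s < t, ω s ∈ bad} = ν bad ^ t := by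
  have h := infinitePi_pi (fun _ : ℕ => ν) (s := Finset.range t) (t := fun _ => bad)
    (fun _ _ => hb)
  rw [Finset.prod_const, Finset.card_range] at h
  rw [← h]
  congr 1
  ext ω
  simp [Set.mem_pi]

lemma measurableSet_forall_lt {bad : Set Y} (hb : MeasurableSet bad) (t : ℕ) :
    MeasurableSet {ω : ℕ → Y | ∀ s < t, ω s ∈ bad} := by
  have : {ω : ℕ → Y | ∀ s < t, ω s ∈ bad} = ⋂ s, ⋂ (_ : s < t), (fun ω => ω s) ⁻¹' bad := by
    ext; simp
  rw [this]
  exact MeasurableSet.iInter fun s => MeasurableSet.iInter fun _ => measurable_pi_apply s hb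

variable {ν} {Ω : Type} [MeasurableSpace Ω] {μ : Measure Ω} {ρ : Ω → ℕ → Y}

lemma measurable_attempts (hρ : Measurable ρ) {bad : Set Y} (hb : MeasurableSet bad) :
    Measurable fun ω => attempts fun s => ρ ω s ∈ bad := by
  unfold attempts
  refine Measurable.tsum fun t => Measurable.ite ?_ measurable_const measurable_const
  exact hρ (measurableSet_forall_lt hb t)

/-- The expected number of independent attempts is the inverse of the probability of success. -/
lemma lintegral_attempts (hρ : Measurable ρ) (hlaw : μ.map ρ = infinitePi fun _ : ℕ => ν)
    {bad : Set Y} (hb : MeasurableSet bad) :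
    ∫⁻ ω, attempts (fun s => ρ ω s ∈ bad) ∂μ = (1 - ν bad)⁻¹ := by
  have hm : ∀ t, MeasurableSet (ρ ⁻¹' {ω : ℕ → Y | ∀ s < t, ω s ∈ bad}) :=
    fun t => hρ (measurableSet_forall_lt hb t)
  have h1 : ∀ ω, attempts (fun s => ρ ω s ∈ bad) =
      ∑' t, (ρ ⁻¹' {ω : ℕ → Y | ∀ s < t, ω s ∈ bad}).indicator 1 ω := by
    intro ω
    refine tsum_congr fun t => ?_
    by_cases h : ∀ s < t, ρ ω s ∈ bad
    · rw [if_pos h, Set.indicator_of_mem (by exact h), Pi.one_apply]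
    · rw [if_neg h, Set.indicator_of_notMem (by exact h)]
  rw [lintegral_congr h1, lintegral_tsum fun t =>
    (measurable_one.indicator (hm t)).aemeasurable, ← ENNReal.tsum_geometric]
  refine tsum_congr fun t => ?_
  rw [lintegral_indicator_one (hm t), ← map_apply hρ (measurableSet_forall_lt hb t), hlaw,
    infinitePi_forall_lt ν hb]

lemma ae_exists_success (hρ : Measurable ρ) (hlaw : μ.map ρ = infinitePi fun _ : ℕ => ν)
    {bad : Set Y} (hb : MeasurableSet bad) (h1 : ν bad < 1) : ∀ᵐ ω ∂μ, ∃ t, ρ ω t ∉ bad := by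
  rw [ae_iff]
  refine le_antisymm (ge_of_tendsto' (ENNReal.tendsto_pow_atTop_nhds_zero_of_lt_one h1) fun t => ?_)
    zero_le
  rw [← infinitePi_forall_lt ν hb, ← hlaw, map_apply hρ (measurableSet_forall_lt hb t)]
  refine measure_mono fun ω hω => ?_
  simp only [not_exists, not_not, Set.mem_ofPred_eq] at hω
  exact fun s _ => hω s

variable (ν) in
/-- The law of the first accepted element of an independent sequence. -/
lemma infinitePi_first_eq [MeasurableSingletonClass Y] {good : Set Y} (hg : MeasurableSet good)
    {a : Y} (ha : a ∈ good) :
    infinitePi (fun _ : ℕ => ν) {ω | ∃ t, ω t = a ∧ ∀ s < t, ω s ∉ good} = (ν good)⁻¹ * ν {a} := by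
  classical
  have h1 : {ω : ℕ → Y | ∃ t, ω t = a ∧ ∀ s < t, ω s ∉ good} =
      ⋃ t, {ω | ω t = a ∧ ∀ s < t, ω s ∉ good} := by
    ext; simp
  have h2 : ∀ t, {ω : ℕ → Y | ω t = a ∧ ∀ s < t, ω s ∉ good} =
      Set.pi (Finset.range (t + 1)) (fun s => if s = t then {a} else goodᶜ) := by
    intro t
    ext ω
    simp only [Set.mem_ofPred_eq, Set.mem_pi, Finset.coe_range, Set.mem_Iio]
    refine ⟨fun h s hs => ?_, fun h => ⟨by simpa using h t (by omega), fun s hs => ?_⟩⟩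
    · by_cases hst : s = t
      · rw [if_pos hst, hst]; exact h.1
      · rw [if_neg hst]; exact h.2 s (by omega)
    · have := h s (by omega)
      rwa [if_neg hs.ne] at this
  have h3 : ∀ s t : ℕ, MeasurableSet (if s = t then {a} else goodᶜ) := by
    intro s t
    split_ifs
    exacts [measurableSet_singleton a, hg.compl]
  rw [h1, measure_iUnion]
  · have h4 : ν goodᶜ = 1 - ν good := prob_compl_eq_one_sub hg
    have h5 : 1 - ν goodᶜ = ν good := by
      rw [← prob_compl_eq_one_sub hg.compl, compl_compl]
    rw [← h5, ← ENNReal.tsum_geometric, ← ENNReal.tsum_mul_right]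
    refine tsum_congr fun t => ?_
    rw [h2, infinitePi_pi _ fun s _ => h3 s t, Finset.prod_range_succ, if_pos rfl]
    congr 1
    rw [Finset.prod_congr rfl (g := fun _ => ν goodᶜ) fun s hs => by
      rw [if_neg (Finset.mem_range.1 hs).ne]]
    simp
  · intro t t' htt'
    refine Set.disjoint_left.2 fun ω hω hω' => htt' ?_
    rcases lt_trichotomy t t' with h | h | h
    · exact absurd (hω.1 ▸ ha) (hω'.2 t h)
    · exact h
    · exact absurd (hω'.1 ▸ ha) (hω.2 t' h)
  · intro t
    rw [h2]
    exact MeasurableSet.pi (Finset.countable_toSet _) fun s _ => h3 s t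

end Sequence

section Tape

lemma infinitePi_map_slice {ι κ X : Type} [MeasurableSpace X] (ν : Measure X)
    [IsProbabilityMeasure ν] (i : ι) :
    (infinitePi fun _ : ι × κ => ν).map (fun ω k => ω (i, k)) = infinitePi fun _ : κ => ν := by
  have h1 := infinitePi_map_curry (fun (_ : ι) (_ : κ) => ν)
  have h2 := infinitePi_map_eval (fun _ : ι => infinitePi fun _ : κ => ν) i
  rw [← h1, Measure.map_map (by fun_prop) (by fun_prop)] at h2
  exact h2

/-- The random vectors of the attempts for one determinant form an independent sequence of uniform
vectors. -/
lemma infinitePi_map_blocks {ι κ J X : Type} [MeasurableSpace X] (ν : Measure X)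
    [IsProbabilityMeasure ν] (i : ι) :
    (infinitePi fun _ : ι × κ × J => ν).map (fun ω k j => ω (i, k, j)) =
      infinitePi fun _ : κ => infinitePi fun _ : J => ν := by
  have h1 := infinitePi_map_curry (fun (_ : κ) (_ : J) => ν)
  rw [← infinitePi_map_slice (ι := ι) ν i, Measure.map_map (by fun_prop) (by fun_prop)] at h1
  exact h1

variable {F : Type} [Fintype F] [Nonempty F] [MeasurableSpace F] [DiscreteMeasurableSpace F]

lemma uniform_apply (S : Set F) :
    (PMF.uniformOfFintype F).toMeasure S = Nat.card S / Nat.card F := by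
  classical
  rw [PMF.toMeasure_uniformOfFintype_apply S (MeasurableSet.of_discrete), Nat.card_eq_fintype_card,
    Nat.card_eq_fintype_card]

lemma infinitePi_uniform_apply {J : Type} [Fintype J] (S : Set (J → F)) :
    infinitePi (fun _ : J => (PMF.uniformOfFintype F).toMeasure) S =
      Nat.card S / Nat.card (J → F) := by
  classical
  have h1 : ∀ f : J → F, infinitePi (fun _ : J => (PMF.uniformOfFintype F).toMeasure) {f} =
      (Nat.card (J → F) : ℝ≥0∞)⁻¹ := by
    intro f
    rw [infinitePi_singleton_of_fintype]
    simp only [uniform_apply]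
    simp [ENNReal.inv_pow]
  have h2 : S = ⋃ f ∈ S.toFinset, {f} := by ext; simp
  have h3 : Nat.card S = S.toFinset.card := by
    rw [Nat.card_eq_fintype_card, Set.toFinset_card]
  rw [h3]
  conv_lhs => rw [h2]
  rw [measure_biUnion_finset (fun a _ b _ hab => by simpa using hab)
    (fun f _ => measurableSet_singleton f), Finset.sum_congr rfl fun f _ => h1 f]
  simp [div_eq_mul_inv]

/-- The first accepted elements of `n` rows of a uniform tape are independent and uniform among the
acceptable elements. -/
lemma measure_first_mem {n : ℕ} {good : Set F} (S : Set (Fin n → good)) :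
    infinitePi (fun _ : ℕ × ℕ => (PMF.uniformOfFintype F).toMeasure)
        {ω | ∃ x ∈ S, ∀ l : Fin n, ∃ t, ω (l, t) = x l ∧ ∀ s < t, ω (l, s) ∉ good} =
      Nat.card S / Nat.card (Fin n → good) := by
  classical
  set ν := (PMF.uniformOfFintype F).toMeasure with hν
  set first : F → Set (ℕ → F) := fun a => {ω | ∃ t, ω t = a ∧ ∀ s < t, ω s ∉ good} with hfirst
  have hmeas : ∀ a, MeasurableSet (first a) := by
    intro a
    have : first a = ⋃ t, ((fun ω => ω t) ⁻¹' {a} ∩ {ω | ∀ s < t, ω s ∈ goodᶜ}) := by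
      ext; simp [hfirst]
    rw [this]
    exact MeasurableSet.iUnion fun t => (measurable_pi_apply t (measurableSet_singleton a)).inter
      (measurableSet_forall_lt MeasurableSet.of_discrete t)
  have hF0 : (Nat.card F : ℝ≥0∞) ≠ 0 := by simp
  have hFt : (Nat.card F : ℝ≥0∞) ≠ ⊤ := ENNReal.natCast_ne_top _
  have hfirstlaw : ∀ a ∈ good, infinitePi (fun _ : ℕ => ν) (first a) =
      (Nat.card good : ℝ≥0∞)⁻¹ := by
    intro a ha
    rw [infinitePi_first_eq ν MeasurableSet.of_discrete ha, hν, uniform_apply, uniform_apply]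
    simp only [Nat.card_unique, Nat.cast_one, one_div]
    rw [ENNReal.inv_div (Or.inl hFt) (Or.inl hF0), div_eq_mul_inv, mul_right_comm,
      ENNReal.mul_inv_cancel hF0 hFt, one_mul]
  set box : (Fin n → good) → Set (ℕ × ℕ → F) := fun x =>
    {ω | ∀ l : Fin n, (fun t => ω (l, t)) ∈ first (x l)} with hbox
  have hboxm : ∀ x, MeasurableSet (box x) := by
    intro x
    have : box x = ⋂ l : Fin n, (fun ω t => ω ((l : ℕ), t)) ⁻¹' first (x l) := by
      ext; simp [hbox]
    rw [this]
    exact MeasurableSet.iInter fun l =>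
      (measurable_pi_lambda _ fun t => measurable_pi_apply _) (hmeas _)
  have hboxlaw : ∀ x, infinitePi (fun _ : ℕ × ℕ => ν) (box x) =
      (Nat.card (Fin n → good) : ℝ≥0∞)⁻¹ := by
    intro x
    set tt : ℕ → Set (ℕ → F) := fun l => if h : l < n then first (x ⟨l, h⟩) else Set.univ with htt
    have httm : ∀ l, MeasurableSet (tt l) := by
      intro l
      simp only [htt]
      split_ifs
      exacts [hmeas _, MeasurableSet.univ]
    have h1 := infinitePi_map_curry (fun (_ : ℕ) (_ : ℕ) => ν)
    have h2 : box x = MeasurableEquiv.curry ℕ ℕ F ⁻¹' Set.pi (Finset.range n) tt := by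
      ext ω
      simp only [hbox, Set.mem_ofPred_eq, Set.mem_preimage, Set.mem_pi, Finset.coe_range,
        Set.mem_Iio]
      refine ⟨fun h l hl => ?_, fun h l => ?_⟩
      · simp only [htt, dif_pos hl]
        exact h ⟨l, hl⟩
      · have := h l l.2
        simp only [htt, dif_pos l.2] at this
        exact this
    rw [h2, ← map_apply (by fun_prop) (MeasurableSet.pi (Finset.countable_toSet _)
      fun l _ => httm l), h1, infinitePi_pi _ fun l _ => httm l,
      Finset.prod_congr rfl (g := fun _ => (Nat.card good : ℝ≥0∞)⁻¹) fun l hl => by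
        simp only [htt, dif_pos (Finset.mem_range.1 hl)]
        exact hfirstlaw _ (x _).2]
    simp [ENNReal.inv_pow]
  have hset : {ω : ℕ × ℕ → F | ∃ x ∈ S, ∀ l : Fin n, ∃ t, ω (l, t) = x l ∧
      ∀ s < t, ω (l, s) ∉ good} = ⋃ x ∈ S.toFinset, box x := by
    ext ω
    simp [hbox, hfirst]
  have hS : Nat.card S = S.toFinset.card := by
    rw [Nat.card_eq_fintype_card, Set.toFinset_card]
  rw [hset, measure_biUnion_finset _ fun x _ => hboxm x, Finset.sum_congr rfl fun x _ => hboxlaw x,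
    hS]
  · simp [div_eq_mul_inv]
  · intro x _ y _ hxy
    refine Set.disjoint_left.2 fun ω hω hω' => hxy ?_
    ext l
    obtain ⟨t, ht, ht'⟩ := hω l
    obtain ⟨s, hs, hs'⟩ := hω' l
    rcases lt_trichotomy t s with h | h | h
    · exact absurd (ht ▸ (x l).2) (hs' t h)
    · subst h; exact ht.symm.trans hs
    · exact absurd (hs ▸ (y l).2) (ht' s h)

end Tape

end Probability

/-! ### The loops of the algorithm -/

namespace Run

variable {α β : Type}

lemma bind_of_val_eq_some {x : Run α} {a : α} (h : x.val = some a) (f : α → Run β) :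
    x >>= f = ⟨(f a).val, x.cost + (f a).cost⟩ := by
  simp only [Bind.bind]
  rw [h]

lemma bind_of_val_eq_none {x : Run α} (h : x.val = none) (f : α → Run β) :
    x >>= f = ⟨none, x.cost⟩ := by
  simp only [Bind.bind]
  rw [h]

@[simp] lemma cost_pure (a : α) : (pure a : Run α).cost = 0 := rfl
@[simp] lemma val_fail : (Run.fail : Run α).val = none := rfl
@[simp] lemma cost_fail : (Run.fail : Run α).cost = 0 := rfl

lemma liftM_bind (x : Timed α) (f : α → Run β) :
    (liftM x : Run α) >>= f = ⟨(f x.val).val, x.cost + (f x.val).cost⟩ := rfl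

end Run

section PointTry

variable {n k : ℕ} {K : Type} [Field K]

open Classical in
lemma pointTryT_val (P : Fin k → K[X]) (Q : K[X]) (a : K) :
    (pointTryT P Q a).val = if (∀ j, (P j).eval a ≠ 0) ∧ Q.eval a ≠ 0
      then some ⟨a, fun j => (P j).eval a, Q.eval a⟩ else none := by
  simp only [pointTryT, Timed.val_bind, drawT_val, forT_val, evalT_val, isZeroT_val,
    Timed.val_pure, decide_eq_false_iff_not]

lemma pointTryT_cost (P : Fin k → K[X]) (Q : K[X]) (a : K) :
    (pointTryT P Q a).cost = 2 * (∑ j, (P j).natDegree + Q.natDegree) + k + 2 := by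
  simp [pointTryT, ← Finset.mul_sum]
  ring

variable {A : Matrix (Fin n) (Fin n) K} {P : Fin k → K[X]}

lemma pointTryT_val_knownPart (hP : Function.Injective P) (hmem : ∀ j, P j ∈ minpolyFactors A)
    {a : K} (ha : A.charpoly.eval a ≠ 0) :
    (pointTryT P (knownPart A P) a).val =
      some ⟨a, fun j => (P j).eval a, (knownPart A P).eval a⟩ := by
  classical
  rw [pointTryT_val, if_pos ((eval_factors_ne_zero_iff hP hmem a).2 ha)]

lemma pointTryT_val_eq_none_iff (hP : Function.Injective P) (hmem : ∀ j, P j ∈ minpolyFactors A)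
    (a : K) : (pointTryT P (knownPart A P) a).val = none ↔ A.charpoly.eval a = 0 := by
  classical
  rw [pointTryT_val, ← not_iff_not, ← ne_eq (eval a A.charpoly),
    ← eval_factors_ne_zero_iff hP hmem a]
  split_ifs with h <;> simp [h]

end PointTry

section Loops

variable {n k p : ℕ} [Fact p.Prime] {K L : Type} [Field K] [Field L] [Algebra K L]
variable {g : Kˣ} {P : Fin k → K[X]} {Q : K[X]}

/-- The row of the linear system that belongs to an accepted point. -/
noncomputable def logRow (p : ℕ) (g : Kˣ) (pt : Point k K) : LogRow k p K :=
  ⟨pt.x, pt.γ, fun j => (dlog g (pt.α j) : ZMod p)⟩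

/-- An upper bound for the cost of adding one row to a triangular system with `k` unknowns. -/
def insertBound (k : ℕ) : ℕ := k * (k * 2 + 2) + (2 * k + 1)

lemma insertT_cost_le_insertBound {F : Type} [Field F] {E : List (Pivot k F)} (hE : E.length ≤ k)
    (v : Fin k → F) (β : F) : (insertT E v β).cost ≤ insertBound k :=
  (insertT_cost_le E v β).trans (Nat.add_le_add_right (Nat.mul_le_mul_right _ hE) _)

/-- Insert the rows of a list, with right-hand sides `0`, as long as they are independent. -/
noncomputable def insertRows : List (Pivot k (ZMod p)) → List (LogRow k p K) →
    Option (List (Pivot k (ZMod p)))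
  | E, [] => some E
  | E, r :: B => (insertT E r.logs 0).val.bind fun E' => insertRows E' B

omit [Field K] in
lemma insertRows_append (E : List (Pivot k (ZMod p))) (B : List (LogRow k p K))
    (r : LogRow k p K) :
    insertRows E (B ++ [r]) = (insertRows E B).bind fun E' => (insertT E' r.logs 0).val := by
  induction B generalizing E with
  | nil => simp [insertRows]
  | cons r' B ih =>
    simp only [List.cons_append, insertRows, ih]
    cases (insertT E r'.logs 0).val <;> rfl

omit [Field K] in
lemma insertRows_length {E E' : List (Pivot k (ZMod p))} {B : List (LogRow k p K)}
    (h : insertRows E B = some E') : E'.length = E.length + B.length := by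
  induction B generalizing E with
  | nil => simp [insertRows] at h; simp [h]
  | cons r B ih =>
    obtain ⟨E₁, h1, h2⟩ := Option.bind_eq_some_iff.1 h
    rw [ih h2, insertT_length h1, List.length_cons]
    ring

section RowLoop

variable {tape : ℕ × ℕ → K}

lemma rowLoop_of_length_eq {E : List (Pivot k (ZMod p))} (hE : E.length = k) (m l : ℕ)
    (B : List (LogRow k p K)) : rowLoop p g P Q tape m l E B = pure B := by
  cases m <;> simp [rowLoop, hE]

lemma rowLoop_zero_of_length_ne {E : List (Pivot k (ZMod p))} (hE : E.length ≠ k) (l : ℕ)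
    (B : List (LogRow k p K)) : rowLoop p g P Q tape 0 l E B = Run.fail := by
  simp [rowLoop, hE]

lemma rowLoop_of_none {E : List (Pivot k (ZMod p))} (hE : E.length ≠ k) (m : ℕ) {l : ℕ}
    (B : List (LogRow k p K))
    (h : (repeatUntil fun t => pointTryT P Q (tape (l, t))).val = none) :
    rowLoop p g P Q tape (m + 1) l E B =
      ⟨none, (repeatUntil fun t => pointTryT P Q (tape (l, t))).cost⟩ := by
  rw [rowLoop, if_neg hE, Run.bind_of_val_eq_none h]

/-- The loop goes on with the extended system if the row is independent, and with the old one
otherwise. -/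
lemma rowLoop_of_some {E : List (Pivot k (ZMod p))} (hE : E.length ≠ k) (m : ℕ) {l : ℕ}
    (B : List (LogRow k p K)) {pt : Point k K}
    (h : (repeatUntil fun t => pointTryT P Q (tape (l, t))).val = some pt) :
    rowLoop p g P Q tape (m + 1) l E B =
      let rest := ((insertT E (logRow p g pt).logs 0).val.elim (rowLoop p g P Q tape m (l + 1) E B)
        fun E' => rowLoop p g P Q tape m (l + 1) E' (B ++ [logRow p g pt]))
      ⟨rest.val, (repeatUntil fun t => pointTryT P Q (tape (l, t))).cost +
        ((k : ℕ∞) + (((insertT E (logRow p g pt).logs 0).cost : ℕ∞) + rest.cost))⟩ := by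
  rw [rowLoop, if_neg hE, Run.bind_of_val_eq_some h, Run.liftM_bind, Run.liftM_bind]
  have h1 : (forT fun j => dlogT g p (pt.α j) : Timed (Fin k → ZMod p)).val =
    (logRow p g pt).logs := rfl
  have h2 : (forT fun j => dlogT g p (pt.α j) : Timed (Fin k → ZMod p)).cost = k := by
    simp [dlogT]
  rw [h1, h2]
  cases (insertT E (logRow p g pt).logs 0).val <;> rfl

lemma rowLoop_spec {good : LogRow k p K → Prop}
    (hgood : ∀ a pt, (pointTryT P Q a).val = some pt → good (logRow p g pt))
    {m l : ℕ} {E : List (Pivot k (ZMod p))} {B B' : List (LogRow k p K)}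
    (h : (rowLoop p g P Q tape m l E B).val = some B') (hEB : insertRows [] B = some E)
    (hB : ∀ r ∈ B, good r) :
    (∀ r ∈ B', good r) ∧ ∃ E', insertRows [] B' = some E' ∧ E'.length = k := by
  induction m generalizing l E B with
  | zero =>
    by_cases hE : E.length = k
    · rw [rowLoop_of_length_eq hE] at h
      obtain rfl := Option.some.inj h
      exact ⟨hB, E, hEB, hE⟩
    · rw [rowLoop_zero_of_length_ne hE] at h
      simp at h
  | succ m ih =>
    by_cases hE : E.length = k
    · rw [rowLoop_of_length_eq hE] at h
      obtain rfl := Option.some.inj h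
      exact ⟨hB, E, hEB, hE⟩
    · cases hpt : (repeatUntil fun t => pointTryT P Q (tape (l, t))).val with
      | none => simp [rowLoop_of_none hE m B hpt] at h
      | some pt =>
        rw [rowLoop_of_some hE m B hpt] at h
        cases hi : (insertT E (logRow p g pt).logs 0).val with
        | none =>
          simp only [hi, Option.elim_none] at h
          exact ih h hEB hB
        | some E' =>
          simp only [hi, Option.elim_some] at h
          refine ih h (by rw [insertRows_append, hEB]; exact hi) fun r hr => ?_
          rcases List.mem_append.1 hr with hr | hr
          · exact hB r hr
          · obtain ⟨t, ht, -⟩ := repeatUntil_val_eq_some hpt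
            rw [List.mem_singleton.1 hr]
            exact hgood _ _ ht

lemma rowLoop_cost_le {c : ℕ} (hc : 0 < c) (hcost : ∀ a, (pointTryT P Q a).cost ≤ c) (m l : ℕ)
    {E : List (Pivot k (ZMod p))} (hE : E.length ≤ k) (B : List (LogRow k p K)) :
    ((rowLoop p g P Q tape m l E B).cost : ℝ≥0∞) ≤ ∑ i ∈ Finset.range m,
      (c * attempts (fun t => (pointTryT P Q (tape (l + i, t))).val = none) +
        ((k + insertBound k : ℕ) : ℝ≥0∞)) := by
  induction m generalizing l E B with
  | zero =>
    by_cases hE' : E.length = k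
    · rw [rowLoop_of_length_eq hE']; simp
    · rw [rowLoop_zero_of_length_ne hE']; simp
  | succ m ih =>
    by_cases hE' : E.length = k
    · rw [rowLoop_of_length_eq hE']; simp
    · refine le_of_le_of_eq ?_ ((add_comm _ _).trans (Finset.sum_range_succ' _ m).symm)
      simp only [add_zero]
      have hRU := repeatUntil_cost_le hc (f := fun t => pointTryT P Q (tape (l, t)))
        fun t => hcost _
      cases hpt : (repeatUntil fun t => pointTryT P Q (tape (l, t))).val with
      | none =>
        rw [rowLoop_of_none hE' m B hpt]
        exact hRU.trans (le_add_right (le_add_right le_rfl))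
      | some pt =>
        rw [rowLoop_of_some hE' m B hpt]
        have hi := insertT_cost_le_insertBound hE (logRow p g pt).logs 0
        have hrest : ((((insertT E (logRow p g pt).logs 0).val.elim
            (rowLoop p g P Q tape m (l + 1) E B)
            fun E' => rowLoop p g P Q tape m (l + 1) E' (B ++ [logRow p g pt])).cost : ℕ∞) : ℝ≥0∞) ≤
            ∑ i ∈ Finset.range m,
              (c * attempts (fun t => (pointTryT P Q (tape (l + (i + 1), t))).val = none) +
                ((k + insertBound k : ℕ) : ℝ≥0∞)) := by
          cases hins : (insertT E (logRow p g pt).logs 0).val with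
          | none => simpa only [Option.elim_none, add_assoc, add_comm 1] using ih (l + 1) hE B
          | some E' =>
            simpa only [Option.elim_some, add_assoc, add_comm 1] using
              ih (l + 1) (E := E') (by rw [insertT_length hins]; omega) (B ++ [logRow p g pt])
        simp only [ENat.toENNReal_add, ENat.toENNReal_coe]
        refine (add_le_add hRU
          (add_le_add le_rfl (add_le_add (Nat.cast_le.2 hi) hrest))).trans_eq ?_
        rw [Nat.cast_add]
        simp only [add_assoc]

/-- If the loop fails although points were found for all rows, then all the rows lie in a space
that is spanned by fewer than `k` vectors. -/
lemma rowLoop_isSome_or {m l : ℕ} {E : List (Pivot k (ZMod p))} (hE : E.length ≤ k)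
    (B : List (LogRow k p K))
    (h : ∀ i < m, ∃ pt, (repeatUntil fun t => pointTryT P Q (tape (l + i, t))).val = some pt) :
    (∃ B', (rowLoop p g P Q tape m l E B).val = some B') ∨
      ∃ E' : List (Pivot k (ZMod p)), E'.length < k ∧
        Submodule.span (ZMod p) (Pivot.row '' {e | e ∈ E}) ≤
          Submodule.span (ZMod p) (Pivot.row '' {e | e ∈ E'}) ∧
        ∀ i < m, ∀ pt, (repeatUntil fun t => pointTryT P Q (tape (l + i, t))).val = some pt →
          (logRow p g pt).logs ∈ Submodule.span (ZMod p) (Pivot.row '' {e | e ∈ E'}) := by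
  induction m generalizing l E B with
  | zero =>
    by_cases hE' : E.length = k
    · rw [rowLoop_of_length_eq hE']
      exact Or.inl ⟨B, rfl⟩
    · exact Or.inr ⟨E, by omega, le_rfl, by simp⟩
  | succ m ih =>
    by_cases hE' : E.length = k
    · rw [rowLoop_of_length_eq hE']
      exact Or.inl ⟨B, rfl⟩
    · obtain ⟨pt, hpt⟩ := h 0 (by omega)
      simp only [add_zero] at hpt
      have h' : ∀ i < m, ∃ pt,
          (repeatUntil fun t => pointTryT P Q (tape (l + 1 + i, t))).val = some pt := fun i hi => by
        have := h (i + 1) (by omega)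
        rwa [show l + (i + 1) = l + 1 + i by ring] at this
      rw [rowLoop_of_some hE' m B hpt]
      -- Whatever happens to the present row, it lies in the span of the new system.
      have key : ∀ (E₁ : List (Pivot k (ZMod p))) (B₁ : List (LogRow k p K)), E₁.length ≤ k →
          Submodule.span (ZMod p) (Pivot.row '' {e | e ∈ E}) ≤
            Submodule.span (ZMod p) (Pivot.row '' {e | e ∈ E₁}) →
          (logRow p g pt).logs ∈ Submodule.span (ZMod p) (Pivot.row '' {e | e ∈ E₁}) →
          (∃ B', (rowLoop p g P Q tape m (l + 1) E₁ B₁).val = some B') ∨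
            ∃ E' : List (Pivot k (ZMod p)), E'.length < k ∧
              Submodule.span (ZMod p) (Pivot.row '' {e | e ∈ E}) ≤
                Submodule.span (ZMod p) (Pivot.row '' {e | e ∈ E'}) ∧
              ∀ i < m + 1, ∀ pt,
                (repeatUntil fun t => pointTryT P Q (tape (l + i, t))).val = some pt →
                (logRow p g pt).logs ∈
                  Submodule.span (ZMod p) (Pivot.row '' {e | e ∈ E'}) := by
        intro E₁ B₁ hE₁ hle hmem
        rcases ih hE₁ B₁ h' with hl | ⟨E', h1, h2, h3⟩
        · exact Or.inl hl
        · refine Or.inr ⟨E', h1, hle.trans h2, fun i hi pt' hpt' => ?_⟩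
          cases i with
          | zero =>
            obtain rfl := Option.some.inj (hpt.symm.trans hpt')
            exact h2 hmem
          | succ i =>
            rw [show l + (i + 1) = l + 1 + i by ring] at hpt'
            exact h3 i (by omega) pt' hpt'
      cases hi : (insertT E (logRow p g pt).logs 0).val with
      | none => exact key E B hE le_rfl (mem_span_row_of_insertT_eq_none hi)
      | some E₁ =>
        exact key E₁ _ (by rw [insertT_length hi]; omega) (span_row_mono hi)
          (mem_span_row_of_insertT_eq_some hi)

end RowLoop

section RhsLoop

variable {A : Matrix (Fin n) (Fin n) K} {Ω : ℕ} {tape : ℕ × ℕ × Fin 3 × Fin n → L}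

lemma rhsLoop_nil (i : ℕ) (E : List (Pivot k (ZMod p))) :
    rhsLoop p A Ω g tape [] i E = pure E := rfl

lemma rhsLoop_of_none {r : LogRow k p K} (B : List (LogRow k p K)) {i : ℕ}
    (E : List (Pivot k (ZMod p)))
    (h : (repeatUntil fun t => detTryT A Ω r.x fun a c => tape (i, t, a, c)).val = none) :
    rhsLoop p A Ω g tape (r :: B) i E =
      ⟨none, (repeatUntil fun t => detTryT A Ω r.x fun a c => tape (i, t, a, c)).cost⟩ := by
  rw [rhsLoop, Run.bind_of_val_eq_none h]

lemma rhsLoop_of_some {r : LogRow k p K} (B : List (LogRow k p K)) {i : ℕ}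
    (E : List (Pivot k (ZMod p))) {δ : K}
    (h : (repeatUntil fun t => detTryT A Ω r.x fun a c => tape (i, t, a, c)).val = some δ) :
    rhsLoop p A Ω g tape (r :: B) i E =
      let ins := insertT E r.logs ((dlog g δ : ZMod p) - dlog g r.γ)
      let rest := ins.val.elim Run.fail fun E' => rhsLoop p A Ω g tape B (i + 1) E'
      ⟨rest.val, (repeatUntil fun t => detTryT A Ω r.x fun a c => tape (i, t, a, c)).cost +
        (1 + (1 + (1 + ((ins.cost : ℕ∞) + rest.cost))))⟩ := by
  rw [rhsLoop, Run.bind_of_val_eq_some h, Run.liftM_bind, Run.liftM_bind, Run.liftM_bind,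
    Run.liftM_bind]
  simp only [subT_val, dlogT, subT_cost]
  cases (insertT E r.logs ((dlog g δ : ZMod p) - dlog g r.γ)).val <;> rfl

/-- The triangular system that the loop returns is satisfied by every vector that satisfies the
given equations with the true values of the determinants. -/
lemma rhsLoop_spec {z : Fin k → ZMod p} {B : List (LogRow k p K)} {i : ℕ}
    {E E' : List (Pivot k (ZMod p))} (h : (rhsLoop p A Ω g tape B i E).val = some E')
    (hB : ∀ r ∈ B, r.logs ⬝ᵥ z = (dlog g (A.charpoly.eval r.x) : ZMod p) - dlog g r.γ)
    (hE : IsTriangular E) (hz : Solves z E) :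
    IsTriangular E' ∧ Solves z E' ∧ E'.length = E.length + B.length := by
  induction B generalizing i E with
  | nil =>
    obtain rfl := Option.some.inj h
    exact ⟨hE, hz, rfl⟩
  | cons r B ih =>
    cases hδ : (repeatUntil fun t => detTryT A Ω r.x fun a c => tape (i, t, a, c)).val with
    | none => simp [rhsLoop_of_none B E hδ] at h
    | some δ =>
      rw [rhsLoop_of_some B E hδ] at h
      obtain ⟨t, ht, -⟩ := repeatUntil_val_eq_some hδ
      have hδ' := detTryT_eq_some A Ω r.x ht
      cases hi : (insertT E r.logs ((dlog g δ : ZMod p) - dlog g r.γ)).val with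
      | none => simp [hi] at h
      | some E₁ =>
        simp only [hi, Option.elim_some] at h
        obtain ⟨h1, h2, h3⟩ := ih h (fun r' hr' => hB r' (List.mem_cons_of_mem _ hr'))
          (insertT_isTriangular hE hi)
          (insertT_solves hz (by rw [hδ']; exact hB r List.mem_cons_self) hi)
        refine ⟨h1, h2, ?_⟩
        rw [h3, insertT_length hi, List.length_cons]
        ring

lemma rhsLoop_isSome {B : List (LogRow k p K)} {i : ℕ} {E E₀ E₁ : List (Pivot k (ZMod p))}
    (hdet : ∀ r ∈ B, ∀ i, ∃ t, (detTryT A Ω r.x fun a c => tape (i, t, a, c)).val ≠ none)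
    (hE₁ : insertRows E₀ B = some E₁) (hs : E₀.map Pivot.shape = E.map Pivot.shape) :
    ∃ E', (rhsLoop p A Ω g tape B i E).val = some E' := by
  induction B generalizing i E E₀ with
  | nil => exact ⟨E, rfl⟩
  | cons r B ih =>
    obtain ⟨E₂, h1, h2⟩ := Option.bind_eq_some_iff.1 hE₁
    obtain ⟨t, ht⟩ := hdet r List.mem_cons_self i
    obtain ⟨δ, hδ⟩ := repeatUntil_val_isSome
      (f := fun t => detTryT A Ω r.x fun a c => tape (i, t, a, c)) ht
    obtain ⟨E₂', h3, h4⟩ := insertT_congr_shape hs ((dlog g δ : ZMod p) - dlog g r.γ) h1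
    rw [rhsLoop_of_some B E hδ]
    simp only [h3, Option.elim_some]
    exact ih (fun r' hr' => hdet r' (List.mem_cons_of_mem _ hr')) h2 h4

lemma rhsLoop_cost_le {c : ℕ} (hc : 0 < c)
    (hcost : ∀ x (r : Fin 3 → Fin n → L), (detTryT A Ω x r).cost ≤ c) (B : List (LogRow k p K))
    (i : ℕ) {E : List (Pivot k (ZMod p))} (hE : E.length + B.length ≤ k) :
    ((rhsLoop p A Ω g tape B i E).cost : ℝ≥0∞) ≤ ∑ j : Fin B.length,
      (c * attempts (fun t =>
        (detTryT A Ω (B.get j).x fun a c => tape (i + j, t, a, c)).val = none) +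
          ((3 + insertBound k : ℕ) : ℝ≥0∞)) := by
  induction B generalizing i E with
  | nil => rw [rhsLoop_nil]; simp
  | cons r B ih =>
    rw [List.length_cons] at hE
    have hRU := repeatUntil_cost_le hc
      (f := fun t => detTryT A Ω r.x fun a c => tape (i, t, a, c)) fun t => hcost _ _
    refine le_of_le_of_eq ?_ (Fin.sum_univ_succ (n := B.length) _).symm
    simp only [List.get_cons_zero, List.get_cons_succ', Fin.val_zero, add_zero, Fin.val_succ]
    cases hδ : (repeatUntil fun t => detTryT A Ω r.x fun a c => tape (i, t, a, c)).val with
    | none =>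
      rw [rhsLoop_of_none B E hδ]
      exact hRU.trans (le_add_right (le_add_right le_rfl))
    | some δ =>
      rw [rhsLoop_of_some B E hδ]
      have hi := insertT_cost_le_insertBound (E := E) (by omega) r.logs
        ((dlog g δ : ZMod p) - dlog g r.γ)
      have hrest : (((((insertT E r.logs ((dlog g δ : ZMod p) - dlog g r.γ)).val.elim Run.fail
          fun E' => rhsLoop p A Ω g tape B (i + 1) E')).cost : ℕ∞) : ℝ≥0∞) ≤
          ∑ j : Fin B.length, (c * attempts (fun t =>
            (detTryT A Ω (B.get j).x fun a c => tape (i + (j + 1), t, a, c)).val = none) +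
              ((3 + insertBound k : ℕ) : ℝ≥0∞)) := by
        cases hins : (insertT E r.logs ((dlog g δ : ZMod p) - dlog g r.γ)).val with
        | none => simp
        | some E' =>
          simpa only [Option.elim_some, add_assoc, add_comm 1] using
            ih (i + 1) (E := E') (by rw [insertT_length hins]; omega)
      simp only [ENat.toENNReal_add, ENat.toENNReal_coe, ENat.toENNReal_one]
      calc _ ≤ (c * attempts (fun t =>
              (detTryT A Ω r.x fun a c => tape (i, t, a, c)).val = none) : ℝ≥0∞) +
            (1 + (1 + (1 + ((insertBound k : ℕ) + ∑ j : Fin B.length, (c * attempts (fun t =>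
            (detTryT A Ω (B.get j).x fun a c => tape (i + (j + 1), t, a, c)).val = none) +
              ((3 + insertBound k : ℕ) : ℝ≥0∞)))))) := by
            gcongr
        _ = _ := by
            push_cast
            ring

end RhsLoop

end Loops

/-! ### Correctness of the answer -/

section Correctness

variable {n k p : ℕ} [Fact p.Prime] {K L : Type} [Field K] [Field L] [Algebra K L]
variable {A : Matrix (Fin n) (Fin n) K} {Ω : ℕ} {g : Kˣ} {P : Fin k → K[X]}

/-- The row consists of the correct data for a point at which the characteristic polynomial does
not vanish. -/
structure IsLogRow (A : Matrix (Fin n) (Fin n) K) (g : Kˣ) (P : Fin k → K[X])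
    (r : LogRow k p K) : Prop where
  eval_charpoly_ne_zero : A.charpoly.eval r.x ≠ 0
  γ_eq : r.γ = (knownPart A P).eval r.x
  logs_eq : r.logs = fun j => (dlog g ((P j).eval r.x) : ZMod p)

lemma isLogRow_logRow (hP : Function.Injective P) (hmem : ∀ j, P j ∈ minpolyFactors A) (a : K)
    (pt : Point k K) (h : (pointTryT P (knownPart A P) a).val = some pt) :
    IsLogRow A g P (logRow p g pt) := by
  have ha : A.charpoly.eval a ≠ 0 := fun h0 => by
    rw [(pointTryT_val_eq_none_iff hP hmem a).2 h0] at h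
    simp at h
  rw [pointTryT_val_knownPart hP hmem ha] at h
  obtain rfl := Option.some.inj h
  exact ⟨ha, rfl, rfl⟩

lemma indexCalculus_of_rowLoop_none {Q : K[X]} {ω : Tape n K L}
    (h : (rowLoop p g P Q ω.1 n 0 [] []).val = none) :
    indexCalculus p A Ω g P Q ω = ⟨none, (rowLoop p g P Q ω.1 n 0 [] []).cost⟩ := by
  rw [indexCalculus, Run.bind_of_val_eq_none h]

lemma indexCalculus_of_rhsLoop_none {Q : K[X]} {ω : Tape n K L} {B : List (LogRow k p K)}
    (h : (rowLoop p g P Q ω.1 n 0 [] []).val = some B)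
    (h' : (rhsLoop p A Ω g ω.2 B 0 []).val = none) :
    indexCalculus p A Ω g P Q ω =
      ⟨none, (rowLoop p g P Q ω.1 n 0 [] []).cost + (rhsLoop p A Ω g ω.2 B 0 []).cost⟩ := by
  rw [indexCalculus, Run.bind_of_val_eq_some h, Run.bind_of_val_eq_none h']

lemma indexCalculus_of_some {Q : K[X]} {ω : Tape n K L} {B : List (LogRow k p K)}
    {E : List (Pivot k (ZMod p))} (h : (rowLoop p g P Q ω.1 n 0 [] []).val = some B)
    (h' : (rhsLoop p A Ω g ω.2 B 0 []).val = some E) :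
    indexCalculus p A Ω g P Q ω =
      let R := ((List.finRange k).foldlM (fun R j => powMulT (P j) ((backSubstT E).val j).val R) Q :
        Timed K[X])
      ⟨some R.val, (rowLoop p g P Q ω.1 n 0 [] []).cost +
        ((rhsLoop p A Ω g ω.2 B 0 []).cost + (((backSubstT E).cost : ℕ∞) + (R.cost : ℕ∞)))⟩ := by
  rw [indexCalculus, Run.bind_of_val_eq_some h, Run.bind_of_val_eq_some h', Run.liftM_bind]
  rfl

/-- Without unknown multiplicities there is nothing to compute. -/
lemma cost_eq_zero {P : Fin 0 → K[X]} (Q : K[X]) (ω : Tape n K L) :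
    (indexCalculus p A Ω g P Q ω).cost = 0 := by
  have h1 : rowLoop p g P Q ω.1 n 0 [] [] = pure [] := rowLoop_of_length_eq rfl _ _ _
  rw [indexCalculus, h1]
  rfl

lemma length_of_rowLoop (hP : Function.Injective P) (hmem : ∀ j, P j ∈ minpolyFactors A)
    {tape : ℕ × ℕ → K} {B : List (LogRow k p K)}
    (h : (rowLoop p g P (knownPart A P) tape n 0 [] []).val = some B) :
    (∀ r ∈ B, IsLogRow A g P r) ∧ B.length = k ∧ ∃ E, insertRows [] B = some E := by
  obtain ⟨h1, E, h2, h3⟩ := rowLoop_spec (isLogRow_logRow hP hmem) h rfl (by simp)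
  refine ⟨h1, ?_, E, h2⟩
  have h4 := insertRows_length h2
  simp only [List.length_nil] at h4
  omega

variable [Fintype K]

/-- The solution of the linear system is the vector of multiplicities, which are less than `p`. -/
lemma val_backSubstT (hg : ∀ y : Kˣ, y ∈ Subgroup.zpowers g) (hp : p ∣ Fintype.card K - 1)
    (hnp : n < p) (hP : Function.Injective P) (hmem : ∀ j, P j ∈ minpolyFactors A)
    {ω : Tape n K L} {B : List (LogRow k p K)} {E : List (Pivot k (ZMod p))}
    (h : (rowLoop p g P (knownPart A P) ω.1 n 0 [] []).val = some B)
    (h' : (rhsLoop p A Ω g ω.2 B 0 []).val = some E) (j : Fin k) :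
    ((backSubstT E).val j).val = multiplicity (P j) A.charpoly := by
  obtain ⟨h1, h2, -⟩ := length_of_rowLoop hP hmem h
  obtain ⟨h3, h4, h5⟩ := rhsLoop_spec (z := fun j => (multiplicity (P j) A.charpoly : ZMod p)) h'
    (fun r hr => by
      rw [(h1 r hr).logs_eq, (h1 r hr).γ_eq]
      exact sum_dlog_mul_multiplicity hg hp hP hmem (h1 r hr).eval_charpoly_ne_zero)
    isTriangular_nil (by simp [Solves])
  rw [backSubstT_val_of_length_eq h3 h4 (by simpa [h2] using h5)]
  exact ZMod.val_natCast_of_lt ((multiplicity_le hP hmem j).trans_lt hnp)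

lemma eq_charpoly_of_val_eq_some (hg : ∀ y : Kˣ, y ∈ Subgroup.zpowers g)
    (hp : p ∣ Fintype.card K - 1) (hnp : n < p) (hP : Function.Injective P)
    (hmem : ∀ j, P j ∈ minpolyFactors A) {ω : Tape n K L} {R : K[X]}
    (h : (indexCalculus p A Ω g P (knownPart A P) ω).val = some R) : R = A.charpoly := by
  cases hB : (rowLoop p g P (knownPart A P) ω.1 n 0 [] []).val with
  | none => simp [indexCalculus_of_rowLoop_none hB] at h
  | some B =>
    cases hE : (rhsLoop p A Ω g ω.2 B 0 []).val with
    | none => simp [indexCalculus_of_rhsLoop_none hB hE] at h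
    | some E =>
      rw [indexCalculus_of_some hB hE] at h
      obtain rfl := Option.some.inj h
      rw [foldlM_powMulT_val, ← Fin.prod_univ_def]
      simp only [val_backSubstT hg hp hnp hP hmem hB hE]
      exact (charpoly_eq_knownPart_mul hP hmem).symm

/-- The cost of the last two steps. -/
lemma final_cost_le (hg : ∀ y : Kˣ, y ∈ Subgroup.zpowers g) (hp : p ∣ Fintype.card K - 1)
    (hnp : n < p) (hP : Function.Injective P) (hmem : ∀ j, P j ∈ minpolyFactors A)
    {ω : Tape n K L} {B : List (LogRow k p K)} {E : List (Pivot k (ZMod p))}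
    (h : (rowLoop p g P (knownPart A P) ω.1 n 0 [] []).val = some B)
    (h' : (rhsLoop p A Ω g ω.2 B 0 []).val = some E) :
    (backSubstT E).cost + ((List.finRange k).foldlM
      (fun R j => powMulT (P j) ((backSubstT E).val j).val R) (knownPart A P) : Timed K[X]).cost ≤
        k * (2 * k + 1) + 4 * (n + 1) * n := by
  obtain ⟨h1, h2, -⟩ := length_of_rowLoop hP hmem h
  obtain ⟨-, -, h5⟩ := rhsLoop_spec (z := fun j => (multiplicity (P j) A.charpoly : ZMod p)) h'
    (fun r hr => by
      rw [(h1 r hr).logs_eq, (h1 r hr).γ_eq]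
      exact sum_dlog_mul_multiplicity hg hp hP hmem (h1 r hr).eval_charpoly_ne_zero)
    isTriangular_nil (by simp [Solves])
  have hx := val_backSubstT hg hp hnp hP hmem h h'
  have hsum := sum_natDegree_add hP hmem
  refine add_le_add (by simp [h5, h2]) ((foldlM_powMulT_cost_le P _ (N := n) _ _ ?_).trans ?_)
  · rw [← Fin.sum_univ_def]
    simp only [hx]
    exact hsum.le
  · rw [← Fin.sum_univ_def]
    simp only [hx]
    calc ∑ j, multiplicity (P j) A.charpoly * ((n + 1) * (((P j).natDegree + 1) * 2))
        ≤ ∑ j, 4 * (n + 1) * (multiplicity (P j) A.charpoly * (P j).natDegree) := by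
          refine Finset.sum_le_sum fun j _ => ?_
          have hd := natDegree_pos_of_mem_minpolyFactors (hmem j)
          calc _ = (n + 1) * multiplicity (P j) A.charpoly * (((P j).natDegree + 1) * 2) := by ring
            _ ≤ (n + 1) * multiplicity (P j) A.charpoly * ((P j).natDegree * 4) :=
              Nat.mul_le_mul_left _ (by omega)
            _ = _ := by ring
      _ ≤ 4 * (n + 1) * n := by
          rw [← Finset.mul_sum]
          exact Nat.mul_le_mul_left _ (by omega)

/-- The algorithm succeeds if the first accepted points of the `n` rows give a matrix of full rank
and the attempts at the determinants do not fail forever. -/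
lemma val_eq_charpoly_of_rank (hg : ∀ y : Kˣ, y ∈ Subgroup.zpowers g)
    (hp : p ∣ Fintype.card K - 1) (hnp : n < p) (hP : Function.Injective P)
    (hmem : ∀ j, P j ∈ minpolyFactors A) {ω : Tape n K L} {x : Fin n → Admissible A}
    (hrank : (dlogMatrix A g p P x).rank = k)
    (hx : ∀ l : Fin n, ∃ t, ω.1 (l, t) = (x l).1 ∧
      ∀ s < t, ω.1 (l, s) ∉ {a : K | ∀ R ∈ minpolyFactors A, R.eval a ≠ 0})
    (hdet : ∀ (i : ℕ) (x : K), A.charpoly.eval x ≠ 0 →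
      ∃ t, (detTryT A Ω x fun a c => ω.2 (i, t, a, c)).val ≠ none) :
    (indexCalculus p A Ω g P (knownPart A P) ω).val = some A.charpoly := by
  classical
  have hpt : ∀ l : Fin n, (repeatUntil fun t => pointTryT P (knownPart A P) (ω.1 (l, t))).val =
      some ⟨(x l).1, fun j => (P j).eval (x l).1, (knownPart A P).eval (x l).1⟩ := by
    intro l
    obtain ⟨t, ht, hs⟩ := hx l
    refine repeatUntil_val_of_first (t := t) ?_ fun s hst => ?_
    · rw [ht]
      exact pointTryT_val_knownPart hP hmem ((forall_eval_ne_zero_iff _).1 (x l).2)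
    · rw [pointTryT_val_eq_none_iff hP hmem]
      by_contra h0
      exact hs s hst ((forall_eval_ne_zero_iff _).2 h0)
  obtain ⟨B, hB⟩ : ∃ B, (rowLoop p g P (knownPart A P) ω.1 n 0 [] []).val = some B := by
    rcases rowLoop_isSome_or (p := p) (g := g) (P := P) (Q := knownPart A P) (tape := ω.1) (m := n)
      (l := 0) (E := []) (by simp) [] (fun i hi => ⟨_, by rw [zero_add]; exact hpt ⟨i, hi⟩⟩) with
      h | ⟨E, h1, -, h2⟩
    · exact h
    · exfalso
      have hle : Submodule.span (ZMod p) (Set.range (dlogMatrix A g p P x).row) ≤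
          Submodule.span (ZMod p) ((E.map Pivot.row).toFinset : Set (Fin k → ZMod p)) := by
        rw [Submodule.span_le]
        rintro _ ⟨l, rfl⟩
        have := h2 l l.2 _ (by rw [zero_add]; exact hpt l)
        have hset : ((E.map Pivot.row).toFinset : Set (Fin k → ZMod p)) =
            Pivot.row '' {e | e ∈ E} := by
          ext; simp
        rw [hset]
        exact this
      have h3 := (Submodule.finrank_mono hle).trans (finrank_span_finset_le_card _)
      rw [← Matrix.rank_eq_finrank_span_row, hrank] at h3
      have h4 := List.toFinset_card_le (E.map Pivot.row)
      rw [List.length_map] at h4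
      omega
  obtain ⟨hgood, -, E₁, hE₁⟩ := length_of_rowLoop hP hmem hB
  obtain ⟨E, hE⟩ := rhsLoop_isSome (A := A) (Ω := Ω) (g := g) (tape := ω.2) (i := 0) (E := [])
    (fun r hr i => hdet i r.x (hgood r hr).eval_charpoly_ne_zero) hE₁ rfl
  have h := indexCalculus_of_some (A := A) (Ω := Ω) hB hE
  have h' := congrArg Run.val h
  rw [h', ← eq_charpoly_of_val_eq_some hg hp hnp hP hmem h']

end Correctness

/-! ### The probability of success -/

section Success

lemma natCast_div_le_inv_two {a b : ℕ} (h : 2 * a ≤ b) : (a : ℝ≥0∞) / b ≤ 2⁻¹ := by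
  refine ENNReal.div_le_of_le_mul ?_
  calc (a : ℝ≥0∞) = 2⁻¹ * (2 * a) := by
        rw [← mul_assoc, ENNReal.inv_mul_cancel two_ne_zero ENNReal.ofNat_ne_top, one_mul]
    _ ≤ 2⁻¹ * b := by gcongr; exact_mod_cast h

lemma inv_one_sub_le_two {a : ℝ≥0∞} (h : a ≤ 2⁻¹) : (1 - a)⁻¹ ≤ 2 := by
  rw [← inv_inv (2 : ℝ≥0∞), ENNReal.inv_le_inv, ← ENNReal.one_sub_inv_two]
  exact tsub_le_tsub_left h 1

lemma add_two_le_card {n p : ℕ} {K : Type} [Field K] [Fintype K] (hp : p ∣ Fintype.card K - 1)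
    (hnp : n < p) : n + 2 ≤ Fintype.card K := by
  have h1 : 1 < Fintype.card K := Fintype.one_lt_card
  have h2 := Nat.le_of_dvd (by omega) hp
  omega

lemma measurable_block {n : ℕ} {L : Type} [MeasurableSpace L] (i : ℕ) :
    Measurable fun (ω : ℕ × ℕ × Fin 3 × Fin n → L) (t : ℕ) (j : Fin 3 × Fin n) => ω (i, t, j) := by
  fun_prop

variable {n k p : ℕ} {K L : Type} [Field K] [Field L] [Fintype L] [MeasurableSpace L]
  [DiscreteMeasurableSpace L] [Algebra K L]
variable {A : Matrix (Fin n) (Fin n) K} {Ω : ℕ} {g : Kˣ} {P : Fin k → K[X]}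

/-- The distribution of the random vectors of one attempt at a determinant. -/
noncomputable def blockMeasure (n : ℕ) (L : Type) [Field L] [Fintype L] [MeasurableSpace L] :
    Measure (Fin 3 × Fin n → L) :=
  Measure.infinitePi fun _ : Fin 3 × Fin n => (PMF.uniformOfFintype L).toMeasure

instance : IsProbabilityMeasure (blockMeasure n L) := by
  unfold blockMeasure
  infer_instance

/-- The random vectors for which an attempt at the determinant of `x • 1 - A` fails. -/
def detFail (L : Type) [Field L] [Algebra K L] (A : Matrix (Fin n) (Fin n) K) (Ω : ℕ) (x : K) :
    Set (Fin 3 × Fin n → L) :=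
  {y | (detTryT A Ω x fun a c => y (a, c)).val = none}

lemma measurableSet_detFail (x : K) : MeasurableSet (detFail L A Ω x) :=
  (Set.toFinite _).measurableSet

variable [Fintype K]

lemma blockMeasure_detFail_le (h3 : Module.finrank K L = 3) (hn : n + 2 ≤ Fintype.card K) {x : K}
    (hx : A.charpoly.eval x ≠ 0) : blockMeasure n L (detFail L A Ω x) ≤ 2⁻¹ := by
  rw [blockMeasure, infinitePi_uniform_apply]
  refine natCast_div_le_inv_two ?_
  have := card_detTryT_eq_none_le (L := L) h3 hn A Ω hx
  simp only [detFail, Set.coe_ofPred]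
  omega

lemma ae_detTryT_ne_none (h3 : Module.finrank K L = 3) (hn : n + 2 ≤ Fintype.card K) :
    ∀ᵐ ω ∂(Measure.infinitePi fun _ : ℕ × ℕ × Fin 3 × Fin n =>
      (PMF.uniformOfFintype L).toMeasure), ∀ (i : ℕ) (x : K), A.charpoly.eval x ≠ 0 →
        ∃ t, (detTryT A Ω x fun a c => ω (i, t, a, c)).val ≠ none := by
  rw [ae_all_iff]
  intro i
  rw [ae_all_iff]
  intro x
  by_cases hx : A.charpoly.eval x = 0
  · simp [hx]
  · have h1 : blockMeasure n L (detFail L A Ω x) < 1 :=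
      (blockMeasure_detFail_le h3 hn hx).trans_lt ENNReal.one_half_lt_one
    filter_upwards [ae_exists_success (measurable_block i) (infinitePi_map_blocks _ i)
      (measurableSet_detFail (A := A) (Ω := Ω) x) h1] with ω hω _
    exact hω

instance : Finite (Admissible A) := Subtype.finite

lemma fullRankProb_le_measure [Fact p.Prime] [MeasurableSpace K] [DiscreteMeasurableSpace K]
    (h3 : Module.finrank K L = 3) (hnp : n < p)
    (hp : p ∣ Fintype.card K - 1) (hg : ∀ y : Kˣ, y ∈ Subgroup.zpowers g)
    (hP : Function.Injective P) (hmem : ∀ j, P j ∈ minpolyFactors A) :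
    ENNReal.ofReal (fullRankProb A g p P) ≤ tapeMeasure n K L
      {ω | (indexCalculus p A Ω g P (knownPart A P) ω).val = some A.charpoly} := by
  set good : Set K := {a : K | ∀ R ∈ minpolyFactors A, R.eval a ≠ 0}
  set S : Set (Fin n → good) := {x | (dlogMatrix A g p P x).rank = k}
  set S₁ : Set (ℕ × ℕ → K) :=
    {ω | ∃ x ∈ S, ∀ l : Fin n, ∃ t, ω (l, t) = x l ∧ ∀ s < t, ω (l, s) ∉ good}
  set S₂ : Set (ℕ × ℕ × Fin 3 × Fin n → L) := {ω | ∀ (i : ℕ) (x : K), A.charpoly.eval x ≠ 0 →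
    ∃ t, (detTryT A Ω x fun a c => ω (i, t, a, c)).val ≠ none}
  have h2 : Measure.infinitePi (fun _ : ℕ × ℕ × Fin 3 × Fin n =>
      (PMF.uniformOfFintype L).toMeasure) S₂ = 1 := by
    rw [measure_congr (Filter.eventuallyEq_univ.2
      (ae_detTryT_ne_none h3 (add_two_le_card (p := p) hp hnp))), measure_univ]
  have h1 := measure_first_mem S
  calc ENNReal.ofReal (fullRankProb A g p P) = Nat.card S / Nat.card (Fin n → good) := by
        have hpos : (0 : ℝ) < Nat.card (Fin n → Admissible A) ∨
            Nat.card (Fin n → Admissible A) = 0 := by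
          rcases Nat.eq_zero_or_pos (Nat.card (Fin n → Admissible A)) with h | h
          · exact Or.inr h
          · exact Or.inl (by exact_mod_cast h)
        rcases hpos with hpos | hzero
        · rw [fullRankProb, ENNReal.ofReal_div_of_pos hpos, ENNReal.ofReal_natCast,
            ENNReal.ofReal_natCast]
          rfl
        · have hS : Nat.card S = 0 := by
            have : IsEmpty (Fin n → good) := by
              rcases Nat.card_eq_zero.1 hzero with h | h
              · exact h
              · exact absurd (inferInstanceAs (Finite (Fin n → Admissible A))) h.not_finite
            exact Nat.card_of_isEmpty
          rw [fullRankProb, hzero, hS]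
          simp
    _ = Measure.infinitePi (fun _ : ℕ × ℕ => (PMF.uniformOfFintype K).toMeasure) S₁ := h1.symm
    _ = tapeMeasure n K L (S₁ ×ˢ S₂) := by
        rw [tapeMeasure, Measure.prod_prod, h2, mul_one]
    _ ≤ _ := by
        refine measure_mono ?_
        rintro ω ⟨⟨x, hxS, hx⟩, hω₂⟩
        exact val_eq_charpoly_of_rank hg hp hnp hP hmem hxS hx hω₂

end Success

/-! ### The expected cost -/

section Cost

variable {n k p : ℕ} [Fact p.Prime] {K L : Type} [Field K] [Fintype K] [Field L]
  [Fintype L] [MeasurableSpace L]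
  [DiscreteMeasurableSpace L] [Algebra K L]
variable {A : Matrix (Fin n) (Fin n) K} {Ω : ℕ} {g : Kˣ} {P : Fin k → K[X]}

lemma lintegral_sum_le {ι Ω : Type} [MeasurableSpace Ω] {μ : Measure Ω} [IsProbabilityMeasure μ]
    (s : Finset ι) {f : ι → Ω → ℝ≥0∞} (hf : ∀ i, Measurable (f i))
    (h : ∀ i ∈ s, ∫⁻ ω, f i ω ∂μ ≤ 2) (c d : ℕ) :
    ∫⁻ ω, ∑ i ∈ s, (c * f i ω + (d : ℝ≥0∞)) ∂μ ≤ ((s.card * (c * 2 + d) : ℕ) : ℝ≥0∞) := by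
  rw [lintegral_finsetSum _ fun i _ => ((hf i).const_mul _).add_const _]
  calc _ ≤ ∑ i ∈ s, ((c * 2 + d : ℕ) : ℝ≥0∞) := by
        refine Finset.sum_le_sum fun i hi => ?_
        rw [lintegral_add_right _ measurable_const, lintegral_const_mul _ (hf i), lintegral_const,
          measure_univ, mul_one]
        push_cast
        gcongr
        exact h i hi
    _ = _ := by simp [mul_add]

lemma lintegral_rhsLoop_cost_le (h3 : Module.finrank K L = 3) (hn : n + 2 ≤ Fintype.card K)
    (hn1 : 1 ≤ n) (hΩ : n ≤ Ω) {B : List (LogRow k p K)} (hB : B.length = k)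
    (hgood : ∀ r ∈ B, A.charpoly.eval r.x ≠ 0) :
    ∫⁻ ω, ((rhsLoop p A Ω g ω B 0 []).cost : ℝ≥0∞)
        ∂(Measure.infinitePi fun _ : ℕ × ℕ × Fin 3 × Fin n =>
          (PMF.uniformOfFintype L).toMeasure) ≤
      ((k * (8000 * (n * Ω) * 2 + (3 + insertBound k)) : ℕ) : ℝ≥0∞) := by
  refine (lintegral_mono fun ω => rhsLoop_cost_le (c := 8000 * (n * Ω))
      (Nat.mul_pos (by norm_num) (Nat.mul_pos hn1 (hn1.trans hΩ)))
    (fun x r => detTryT_cost_le A Ω x h3 hn1 hΩ r) B 0 (by simp [hB])).trans ?_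
  have h := lintegral_sum_le (μ := Measure.infinitePi fun _ : ℕ × ℕ × Fin 3 × Fin n =>
      (PMF.uniformOfFintype L).toMeasure) (Finset.univ : Finset (Fin B.length))
    (f := fun j ω => attempts fun t => (fun j' => ω (0 + j, t, j')) ∈ detFail L A Ω (B.get j).x)
    (fun j => measurable_attempts (measurable_block (0 + (j : ℕ))) (measurableSet_detFail _))
    (fun j _ => ?_) (8000 * (n * Ω)) (3 + insertBound k)
  · refine h.trans (le_of_eq ?_)
    rw [Finset.card_univ, Fintype.card_fin, hB]
  · rw [lintegral_attempts (ν := blockMeasure n L) (measurable_block (0 + (j : ℕ)))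
      (infinitePi_map_blocks _ _) (measurableSet_detFail _)]
    exact inv_one_sub_le_two (blockMeasure_detFail_le h3 hn (hgood _ (List.get_mem B j)))

variable [MeasurableSpace K] [DiscreteMeasurableSpace K]

lemma lintegral_rowLoop_cost_le (hq : 2 * n ≤ Fintype.card K) (hP : Function.Injective P)
    (hmem : ∀ j, P j ∈ minpolyFactors A) :
    ∫⁻ ω, ((rowLoop p g P (knownPart A P) ω n 0 [] []).cost : ℝ≥0∞)
        ∂(Measure.infinitePi fun _ : ℕ × ℕ => (PMF.uniformOfFintype K).toMeasure) ≤
      ((n * ((3 * n + 2) * 2 + (k + insertBound k)) : ℕ) : ℝ≥0∞) := by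
  classical
  set bad : Set K := {a | (pointTryT P (knownPart A P) a).val = none}
  have hbad : MeasurableSet bad := MeasurableSet.of_discrete
  have hprob : (PMF.uniformOfFintype K).toMeasure bad ≤ 2⁻¹ := by
    rw [uniform_apply]
    refine natCast_div_le_inv_two ?_
    have h1 : Nat.card bad = (Finset.univ.filter fun a : K => A.charpoly.eval a = 0).card := by
      rw [← Fintype.card_subtype, ← Nat.card_eq_fintype_card]
      exact Nat.card_congr
        (Equiv.subtypeEquivRight fun a => pointTryT_val_eq_none_iff hP hmem a)
    have h2 := card_roots_charpoly_le A
    rw [h1, Nat.card_eq_fintype_card]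
    omega
  have hρ : ∀ i : ℕ, Measurable fun (ω : ℕ × ℕ → K) (t : ℕ) => ω (0 + i, t) := fun i => by fun_prop
  have hcost : ∀ a, (pointTryT P (knownPart A P) a).cost ≤ 3 * n + 2 := by
    intro a
    rw [pointTryT_cost]
    have h1 := sum_natDegree_le hP hmem
    have h2 := card_factors_le hP hmem
    omega
  refine (lintegral_mono fun ω =>
    rowLoop_cost_le (E := []) (by omega) hcost n 0 (by simp) []).trans ?_
  have h := lintegral_sum_le
    (μ := Measure.infinitePi fun _ : ℕ × ℕ => (PMF.uniformOfFintype K).toMeasure) (Finset.range n)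
    (f := fun i ω => attempts fun t => ω (0 + i, t) ∈ bad)
    (fun i => measurable_attempts (hρ i) hbad) (fun i _ => ?_) (3 * n + 2) (k + insertBound k)
  · rw [Finset.card_range] at h
    exact h
  · rw [lintegral_attempts (hρ i) (infinitePi_map_slice _ _) hbad]
    exact inv_one_sub_le_two hprob

lemma lintegral_cost_le (h3 : Module.finrank K L = 3) (hnp : n < p)
    (hp : p ∣ Fintype.card K - 1) (hg : ∀ y : Kˣ, y ∈ Subgroup.zpowers g)
    (hP : Function.Injective P) (hmem : ∀ j, P j ∈ minpolyFactors A) (hn1 : 1 ≤ n) (hΩ : n ≤ Ω)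
    (hq : 2 * n ≤ Fintype.card K) :
    ∫⁻ ω : Tape n K L,
        ((indexCalculus p A Ω g P (knownPart A P) ω).cost : ℝ≥0∞) ∂(tapeMeasure n K L) ≤
      ((n * ((3 * n + 2) * 2 + (k + insertBound k)) +
        (k * (8000 * (n * Ω) * 2 + (3 + insertBound k)) +
          (k * (2 * k + 1) + 4 * (n + 1) * n)) : ℕ) : ℝ≥0∞) := by
  set D := k * (8000 * (n * Ω) * 2 + (3 + insertBound k)) + (k * (2 * k + 1) + 4 * (n + 1) * n)
    with hD
  rw [tapeMeasure]
  refine (lintegral_prod_le _).trans ?_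
  have key : ∀ ω₁ : ℕ × ℕ → K,
      ∫⁻ ω₂, ((indexCalculus p A Ω g P (knownPart A P) (ω₁, ω₂)).cost : ℝ≥0∞)
        ∂(Measure.infinitePi fun _ : ℕ × ℕ × Fin 3 × Fin n =>
          (PMF.uniformOfFintype L).toMeasure) ≤
      ((rowLoop p g P (knownPart A P) ω₁ n 0 [] []).cost : ℝ≥0∞) + (D : ℝ≥0∞) := by
    intro ω₁
    cases hB : (rowLoop p g P (knownPart A P) ω₁ n 0 [] []).val with
    | none =>
      refine (lintegral_mono (g := fun _ =>
        ((rowLoop p g P (knownPart A P) ω₁ n 0 [] []).cost : ℝ≥0∞)) fun ω₂ => ?_).trans ?_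
      · rw [indexCalculus_of_rowLoop_none (ω := (ω₁, ω₂)) hB]
      · rw [lintegral_const, measure_univ, mul_one]
        exact le_add_right le_rfl
    | some B =>
      obtain ⟨hgood, hlen, -⟩ := length_of_rowLoop hP hmem hB
      have hrhs := lintegral_rhsLoop_cost_le (L := L) (g := g) h3
        (add_two_le_card (p := p) hp hnp) hn1 hΩ hlen
        fun r hr => (hgood r hr).eval_charpoly_ne_zero
      refine (lintegral_mono (g := fun ω₂ =>
        ((rowLoop p g P (knownPart A P) ω₁ n 0 [] []).cost : ℝ≥0∞) +
          (((rhsLoop p A Ω g ω₂ B 0 []).cost : ℝ≥0∞) +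
            ((k * (2 * k + 1) + 4 * (n + 1) * n : ℕ) : ℝ≥0∞))) fun ω₂ => ?_).trans ?_
      · cases hE : (rhsLoop p A Ω g ω₂ B 0 []).val with
        | none =>
          rw [indexCalculus_of_rhsLoop_none (ω := (ω₁, ω₂)) hB hE]
          simp only [ENat.toENNReal_add]
          exact add_le_add le_rfl (le_add_right le_rfl)
        | some E =>
          have hfin := final_cost_le (ω := (ω₁, ω₂)) hg hp hnp hP hmem hB hE
          rw [indexCalculus_of_some (ω := (ω₁, ω₂)) hB hE]
          simp only [ENat.toENNReal_add, ENat.toENNReal_coe]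
          refine add_le_add le_rfl (add_le_add le_rfl ?_)
          rw [← Nat.cast_add]
          exact Nat.cast_le.2 hfin
      · rw [lintegral_add_left measurable_const, lintegral_add_right _ measurable_const,
          lintegral_const, lintegral_const, measure_univ, mul_one, mul_one, hD,
          Nat.cast_add (k * (8000 * (n * Ω) * 2 + (3 + insertBound k)))]
        gcongr
  refine (lintegral_mono key).trans ?_
  rw [lintegral_add_right _ measurable_const, lintegral_const, measure_univ, mul_one,
    Nat.cast_add (n * ((3 * n + 2) * 2 + (k + insertBound k)))]
  exact add_le_add (lintegral_rowLoop_cost_le hq hP hmem) le_rfl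

lemma cost_bound {n k Ω : ℕ} (hk : 1 ≤ k) (hkn : k ≤ n) (hΩ : n ≤ Ω) :
    n * ((3 * n + 2) * 2 + (k + insertBound k)) +
      (k * (8000 * (n * Ω) * 2 + (3 + insertBound k)) + (k * (2 * k + 1) + 4 * (n + 1) * n)) ≤
        20000 * (k * n * Ω) := by
  have hn : 1 ≤ n := hk.trans hkn
  have hΩ1 : 1 ≤ Ω := hn.trans hΩ
  have hins : insertBound k ≤ 7 * (k * n) := by
    unfold insertBound
    have h1 : k * k ≤ k * n := Nat.mul_le_mul_left _ hkn
    have h2 : k ≤ k * n := Nat.le_mul_of_pos_right _ hn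
    nlinarith
  have hkk : k ≤ k * n := Nat.le_mul_of_pos_right _ hn
  have hnk : n ≤ k * n := Nat.le_mul_of_pos_left _ hk
  have e1 : n * ((3 * n + 2) * 2 + (k + insertBound k)) ≤ 18 * (k * n * Ω) := by
    calc _ ≤ n * (10 * (k * n) + (k * n + 7 * (k * n))) := by
          refine Nat.mul_le_mul_left _ (add_le_add ?_ (add_le_add hkk hins))
          omega
      _ = 18 * (k * n * n) := by ring
      _ ≤ 18 * (k * n * Ω) := by gcongr
  have e2 : k * (8000 * (n * Ω) * 2 + (3 + insertBound k)) ≤ 16010 * (k * n * Ω) := by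
    have h1 : k * n ≤ n * Ω := by
      rw [mul_comm k]
      exact Nat.mul_le_mul_left _ (hkn.trans hΩ)
    have h2 : 1 ≤ n * Ω := Nat.mul_pos hn hΩ1
    calc _ ≤ k * (8000 * (n * Ω) * 2 + (3 * (n * Ω) + 7 * (n * Ω))) := by
          gcongr
          · omega
          · omega
      _ = 16010 * (k * n * Ω) := by ring
  have e3 : k * (2 * k + 1) + 4 * (n + 1) * n ≤ 11 * (k * n * Ω) := by
    calc _ ≤ k * (3 * n) + 4 * (2 * n) * n := by
          gcongr
          · omega
          · omega
      _ = 3 * (k * n * 1) + 8 * (1 * n * n) := by ring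
      _ ≤ 3 * (k * n * Ω) + 8 * (k * n * Ω) := by gcongr
      _ = _ := by ring
  omega

end Cost

end IndexCalculus

open IndexCalculus in
theorem mainTheorem4 :
    ∃ C : ℕ, ∀ (n k p Ω : ℕ) [Fact p.Prime]
      (K : Type) [Field K] [Fintype K] [MeasurableSpace K] [DiscreteMeasurableSpace K]
      (L : Type) [Field L] [Fintype L] [MeasurableSpace L] [DiscreteMeasurableSpace L]
      [Algebra K L]
      (A : Matrix (Fin n) (Fin n) K) (g : Kˣ) (P : Fin k → K[X]),
      Module.finrank K L = 3 →
      n < p → p ∣ Fintype.card K - 1 →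
      (∀ y : Kˣ, y ∈ Subgroup.zpowers g) →
      Function.Injective P → (∀ j, P j ∈ minpolyFactors A) →
      n ≤ Ω →
      -- an answer other than "fail" is always the characteristic polynomial
      (∀ (ω : Tape n K L) (R : K[X]),
        (indexCalculus p A Ω g P (knownPart A P) ω).val = some R → R = A.charpoly) ∧
      -- under the conjecture, the characteristic polynomial is returned with high probability
      (∀ ε : ℝ, DlogConjecture A g p P ε →
        ENNReal.ofReal (1 - ε) ≤ tapeMeasure n K L
          {ω | (indexCalculus p A Ω g P (knownPart A P) ω).val = some A.charpoly}) ∧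
      -- the expected number of operations
      (2 * n ≤ Fintype.card K →
        ∫⁻ ω : Tape n K L,
            ((indexCalculus p A Ω g P (knownPart A P) ω).cost : ℝ≥0∞) ∂(tapeMeasure n K L)
          ≤ ((C * (k * n * Ω) : ℕ) : ℝ≥0∞)) := by
  refine ⟨20000, fun n k p Ω _ K _ _ _ _ L _ _ _ _ _ A g P h3 hnp hp hg hP hmem hΩ =>
    ⟨fun ω R h => eq_charpoly_of_val_eq_some hg hp hnp hP hmem h, fun ε hε => ?_, fun hq => ?_⟩⟩
  · exact (ENNReal.ofReal_le_ofReal hε).trans (fullRankProb_le_measure h3 hnp hp hg hP hmem)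
  · rcases Nat.eq_zero_or_pos k with rfl | hk
    · simp [cost_eq_zero]
    · have hkn := card_factors_le hP hmem
      exact (lintegral_cost_le h3 hnp hp hg hP hmem (hk.trans_le hkn) hΩ hq).trans
        (Nat.cast_le.2 (cost_bound hk hkn hΩ))
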